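/- Let $K$ be a field, and let $H=H(-;K)$ be singular homology with coefficients in $K$, either in one fixed degree $k\ge 0$ or the total homology $\bigoplus_k H_k$. Let $n\ge 0$, equip $\mathbb{R}^n$ with the Euclidean distance and $\mathbb{R}^n\times\mathbb{R}^n$ with the maximum of the two Euclidean distances, let $d_A$ denote the infimum distance to a set $A$ (with $d_\emptyset=\infty$), and put $A_r=d_A^{-1}[0,r]$ for $r\in\mathbb{R}$ (so $A_r=\emptyset$ for $r<0$). Let $d_H$ be the Hausdorff distance in $\mathbb{R}^n\times\mathbb{R}^n$, with values in $[0,\infty]$. For $U\subset\mathbb{R}^n$ and a map $h\colon U\to\mathbb{R}^n$ (not necessarily continuous) with graph $\mathrm{Gr}(h)$, the projections induce representations $HU_r\leftarrow H\mathrm{Gr}(h)_r\to Hh(U)_r$ of the quiver $1\leftarrow 2\to 3$, and for $r\le s$ the inclusions induce morphisms between them. If these homologies are finite-dimensional for all $r$, choose for each $r$ an isomorphism of the representation with a finite direct sum $\bigoplus_{1\le b\le d\le 3}\mathbb{I}[b,d]^{m^r_{b,d}}$ of interval representations. The $\mathbb{R}$-persistence module $M^h$ has the spaces $K^{m^r_{1,3}}$,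 and its transition maps are the blocks $\mathbb{I}[1,3]^{m^r_{1,3}}\to\mathbb{I}[1,3]^{m^s_{1,3}}$ of the induced morphisms. In this case $M^h$ is said to be defined. (1) Let $U,U'\subset\mathbb{R}^n$, and let $h\colon U\to\mathbb{R}^n$ and $h'\colon U'\to\mathbb{R}^n$ be maps for which $M^h$ and $M^{h'}$ are defined. Then, for all choices of the decompositions, $$d_I(M^h,M^{h'})\le d_H(\mathrm{Gr}(h),\mathrm{Gr}(h')),$$ where $d_I$ is the interleaving distance, the infimum of the $\delta\ge 0$ for which the two modules are $\delta$-interleaved. (2) In particular, let $S\subset X\subset\mathbb{R}^n$ and $f\colon X\to\mathbb{R}^n$ be such that $M^f$ and $M^{f|_S}$ are defined. If $D$ and $D'$ are persistence diagrams of $M^f$ and $M^{f|_S}$, that is, multisets of intervals of $\mathbb{R}$ such that the modules are isomorphic to the direct sums of the corresponding interval modules, then the bottleneck distance satisfies $$d_B(D',D)\le d_H(\mathrm{Gr}(f),\mathrm{Gr}(f|_S)).$$ -/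

import Mathlib

open CategoryTheory CategoryTheory.Limits
open scoped ENNReal NNReal

noncomputable section

namespace SampledMap

universe u

/-! ### Representations of the quiver `1 ← 2 → 3` -/

section Representations

variable (K : Type u) [Field K]

/-- Representations of the quiver `1 ← 2 → 3` by `K`-vector spaces: functors from the free
category `left ← zero → right` on this quiver. The vertices `1`, `2`, `3` are
`WalkingSpan.left`, `WalkingSpan.zero`, `WalkingSpan.right`. -/
abbrev Rep : Type (u + 1) := WalkingSpan ⥤ ModuleCat.{u} K

instance : HasFiniteBiproducts (Rep K) := HasFiniteBiproducts.of_hasFiniteProducts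

/-- The intervals `[b, d]` with `1 ≤ b ≤ d ≤ 3`; `ibd` stands for `[b, d]`. -/
inductive Interval3
  | i11 | i22 | i33 | i12 | i23 | i13

/-- The field `K` as a vector space. -/
abbrev kk : ModuleCat.{u} K := ModuleCat.of K K

/-- The zero vector space. -/
abbrev oo : ModuleCat.{u} K := ModuleCat.of K PUnit.{u + 1}

/-- The interval representation `𝕀[b, d]`: the space `K` at the vertices `b, …, d` with identity
maps between them, and `0` at the other vertices. (`span f g` is the representation
`Y ← X → Z` with `f : X ⟶ Y` and `g : X ⟶ Z`.) -/
def intervalRep : Interval3 → Rep K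
  | .i11 => span (0 : oo K ⟶ kk K) (0 : oo K ⟶ oo K)
  | .i22 => span (0 : kk K ⟶ oo K) (0 : kk K ⟶ oo K)
  | .i33 => span (0 : oo K ⟶ oo K) (0 : oo K ⟶ kk K)
  | .i12 => span (𝟙 (kk K)) (0 : kk K ⟶ oo K)
  | .i23 => span (0 : kk K ⟶ oo K) (𝟙 (kk K))
  | .i13 => span (𝟙 (kk K)) (𝟙 (kk K))

variable {K}

/-- An indecomposable decomposition of a representation `V` of `1 ← 2 → 3`: an isomorphism of
representations from `V` to a finite direct sum of interval representations. The multiplicity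
`m_{b,d}` is the number of `j` with `kind j = ibd`. -/
structure IntervalDecomposition (V : Rep K) where
  /-- the number of summands -/
  num : ℕ
  /-- the interval of each summand -/
  kind : Fin num → Interval3
  /-- the isomorphism -/
  iso : V ≅ ⨁ fun j => intervalRep K (kind j)

namespace IntervalDecomposition

variable {V W X : Rep K}

/-- The summand `𝕀[1, 3]^{m_{1,3}}` of the direct sum. -/
def part13 (d : IntervalDecomposition V) : Rep K :=
  ⨁ Subtype.restrict (fun j => d.kind j = .i13) fun j => intervalRep K (d.kind j)

/-- The injection of `𝕀[1, 3]^{m_{1,3}}`. -/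
def incl (d : IntervalDecomposition V) : d.part13 ⟶ V :=
  biproduct.fromSubtype (fun j => intervalRep K (d.kind j)) (fun j => d.kind j = .i13) ≫ d.iso.inv

/-- The projection to `𝕀[1, 3]^{m_{1,3}}`. -/
def proj (d : IntervalDecomposition V) : V ⟶ d.part13 :=
  d.iso.hom ≫ biproduct.toSubtype (fun j => intervalRep K (d.kind j)) (fun j => d.kind j = .i13)

/-- The block at `([1, 3], [1, 3])` of the block matrix form of a morphism `φ`, relative to
decompositions of its source and target: `π ∘ Φ ∘ ι` with `Φ` the morphism between the direct
sums that corresponds to `φ`. -/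
def block (d : IntervalDecomposition V) (e : IntervalDecomposition W) (φ : V ⟶ W) :
    d.part13 ⟶ e.part13 :=
  d.incl ≫ φ ≫ e.proj

lemma incl_proj (d : IntervalDecomposition V) : d.incl ≫ d.proj = 𝟙 d.part13 := by
  simp [incl, proj, part13]

lemma block_id (d : IntervalDecomposition V) : d.block d (𝟙 V) = 𝟙 d.part13 := by
  simp [block, incl_proj]

lemma hom13_eq_zero {h : intervalRep K .i13 ⟶ intervalRep K .i13} (v : WalkingSpan)
    (hv : h.app v = 0) : h = 0 := by
  have h1 := h.naturality WalkingSpan.Hom.fst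
  have h2 := h.naturality WalkingSpan.Hom.snd
  have e1 : (intervalRep K .i13).map WalkingSpan.Hom.fst = 𝟙 (kk K) := rfl
  have e2 : (intervalRep K .i13).map WalkingSpan.Hom.snd = 𝟙 (kk K) := rfl
  have h1' : h.app .left = h.app .zero := (Category.id_comp _).symm.trans (h1.trans
    (Category.comp_id _))
  have h2' : h.app .right = h.app .zero := (Category.id_comp _).symm.trans (h2.trans
    (Category.comp_id _))
  have h0 : h.app .zero = 0 := by
    rcases v with _ | _ | _
    · exact hv
    · exact h1'.symm.trans hv
    · exact h2'.symm.trans hv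
  refine NatTrans.ext (funext ?_)
  rintro (_ | _ | _)
  · exact h0
  · exact h1'.trans h0
  · exact h2'.trans h0

lemma isZero_oo : IsZero (oo K) := ModuleCat.isZero_of_subsingleton _

lemma comp_eq_zero {I J J' : Interval3} (hI : I ≠ .i13) (hJ : J = .i13) (hJ' : J' = .i13)
    (f : intervalRep K J ⟶ intervalRep K I) (g : intervalRep K I ⟶ intervalRep K J') :
    f ≫ g = 0 := by
  subst hJ hJ'
  have key : ∀ v, IsZero ((intervalRep K I).obj v) → f ≫ g = 0 := fun v hz =>
    hom13_eq_zero v (by rw [NatTrans.comp_app, hz.eq_of_tgt (f.app v) 0, zero_comp])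
  cases I
  · exact key .right isZero_oo
  · exact key .right isZero_oo
  · exact key .left isZero_oo
  · exact key .right isZero_oo
  · exact key .left isZero_oo
  · exact absurd rfl hI

lemma comp_eq_comp_toSubtype_fromSubtype {l m n : ℕ} (k : Fin l → Interval3)
    (k' : Fin m → Interval3) (k'' : Fin n → Interval3)
    (A : (⨁ Subtype.restrict (fun j => k j = .i13) fun j => intervalRep K (k j)) ⟶
      ⨁ fun j => intervalRep K (k' j))
    (B : (⨁ fun j => intervalRep K (k' j)) ⟶
      ⨁ Subtype.restrict (fun j => k'' j = .i13) fun j => intervalRep K (k'' j)) :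
    A ≫ B = A ≫ (biproduct.toSubtype (fun j => intervalRep K (k' j)) (fun j => k' j = .i13) ≫
      biproduct.fromSubtype (fun j => intervalRep K (k' j)) (fun j => k' j = .i13)) ≫ B := by
  classical
  have aux : ∀ (J J' : Interval3) (_ : J = .i13) (_ : J' = .i13)
      (a : intervalRep K J ⟶ ⨁ fun j => intervalRep K (k' j))
      (b : (⨁ fun j => intervalRep K (k' j)) ⟶ intervalRep K J'),
      a ≫ b = a ≫ (biproduct.toSubtype (fun j => intervalRep K (k' j)) (fun j => k' j = .i13) ≫
        biproduct.fromSubtype (fun j => intervalRep K (k' j)) (fun j => k' j = .i13)) ≫ b := by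
    intro J J' hJ hJ' a b
    rw [biproduct.toSubtype_fromSubtype, biproduct.map_eq]
    conv_lhs => rw [← Category.id_comp b, ← biproduct.total]
    rw [Preadditive.sum_comp, Preadditive.comp_sum, Preadditive.sum_comp, Preadditive.comp_sum]
    refine Finset.sum_congr rfl fun i _ => ?_
    split_ifs with hi
    · simp
    · have := comp_eq_zero hi hJ hJ' (a ≫ biproduct.π (fun j => intervalRep K (k' j)) i)
        (biproduct.ι (fun j => intervalRep K (k' j)) i ≫ b)
      simpa using this
  refine biproduct.hom_ext' _ _ fun j => biproduct.hom_ext _ _ fun i => ?_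
  have := aux _ _ j.2 i.2
    (biproduct.ι (Subtype.restrict (fun j => k j = .i13) fun j => intervalRep K (k j)) j ≫ A)
    (B ≫ biproduct.π (Subtype.restrict (fun j => k'' j = .i13) fun j => intervalRep K (k'' j)) i)
  simp only [Category.assoc] at this ⊢
  exact this

lemma block_comp (d : IntervalDecomposition V) (e : IntervalDecomposition W)
    (c : IntervalDecomposition X) (φ : V ⟶ W) (ψ : W ⟶ X) :
    d.block c (φ ≫ ψ) = d.block e φ ≫ e.block c ψ := by
  have main : ∀ (A : d.part13 ⟶ ⨁ fun j => intervalRep K (e.kind j))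
      (B : (⨁ fun j => intervalRep K (e.kind j)) ⟶ c.part13),
      A ≫ B = A ≫ (biproduct.toSubtype (fun j => intervalRep K (e.kind j))
          (fun j => e.kind j = .i13) ≫
        biproduct.fromSubtype (fun j => intervalRep K (e.kind j)) (fun j => e.kind j = .i13)) ≫ B :=
    comp_eq_comp_toSubtype_fromSubtype d.kind e.kind c.kind
  have hpi : e.proj ≫ e.incl = e.iso.hom ≫ (biproduct.toSubtype
        (fun j => intervalRep K (e.kind j)) (fun j => e.kind j = .i13) ≫
      biproduct.fromSubtype (fun j => intervalRep K (e.kind j)) (fun j => e.kind j = .i13)) ≫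
        e.iso.inv := by
    unfold proj incl part13
    simp only [Category.assoc]
  calc d.block c (φ ≫ ψ)
      = (d.incl ≫ φ ≫ e.iso.hom) ≫ (e.iso.inv ≫ ψ ≫ c.proj) := by simp [block]
    _ = d.incl ≫ φ ≫ (e.iso.hom ≫ (biproduct.toSubtype
        (fun j => intervalRep K (e.kind j)) (fun j => e.kind j = .i13) ≫
      biproduct.fromSubtype (fun j => intervalRep K (e.kind j)) (fun j => e.kind j = .i13)) ≫
        e.iso.inv) ≫ ψ ≫ c.proj := by rw [main]; simp only [Category.assoc]
    _ = d.block e φ ≫ e.block c ψ := by rw [← hpi]; simp only [block, Category.assoc]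

end IntervalDecomposition

section Existence

variable {V W : Rep K}

lemma exists_splitting {I : Interval3} (i : intervalRep K I ⟶ V) (ρ : V ⟶ intervalRep K I)
    (h : i ≫ ρ = 𝟙 _) :
    ∃ (W : Rep K) (j : W ⟶ V) (π : V ⟶ W), i ≫ π = 0 ∧ j ≫ ρ = 0 ∧ j ≫ π = 𝟙 W ∧
      ρ ≫ i + π ≫ j = 𝟙 V := by
  refine ⟨kernel ρ, kernel.ι ρ, kernel.lift ρ (𝟙 V - ρ ≫ i) (by simp [h]), ?_, by simp, ?_,
    by simp⟩
  · rw [← cancel_mono (kernel.ι ρ)]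
    simp [reassoc_of% h]
  · rw [← cancel_mono (kernel.ι ρ)]
    simp

/-- The data of an indecomposable decomposition in terms of injections and projections. -/
def IntervalDecomposition.ofTotal {N : ℕ} (kind : Fin N → Interval3)
    (ι : ∀ j, intervalRep K (kind j) ⟶ V) (π : ∀ j, V ⟶ intervalRep K (kind j))
    (h1 : ∀ j, ι j ≫ π j = 𝟙 _) (h2 : ∀ j k, j ≠ k → ι j ≫ π k = 0)
    (h3 : ∑ j, π j ≫ ι j = 𝟙 V) : IntervalDecomposition V where
  num := N
  kind := kind
  iso :=
    let b : Bicone fun j => intervalRep K (kind j) :=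
      { pt := V
        π := π
        ι := ι
        ι_π := fun j k => by
          split_ifs with hjk
          · subst hjk; simp [h1]
          · exact h2 j k hjk }
    biproduct.uniqueUpToIso _ (b := b) (isBilimitOfTotal b h3)

lemma nonempty_cons {I : Interval3} (i : intervalRep K I ⟶ V) (ρ : V ⟶ intervalRep K I)
    (h : i ≫ ρ = 𝟙 _) (j : W ⟶ V) (π : V ⟶ W) (hπ : i ≫ π = 0) (hρ : j ≫ ρ = 0)
    (hj : j ≫ π = 𝟙 W) (ht : ρ ≫ i + π ≫ j = 𝟙 V) (d : IntervalDecomposition W) :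
    Nonempty (IntervalDecomposition V) := by
  refine ⟨IntervalDecomposition.ofTotal (N := d.num + 1) (Fin.cons I d.kind)
    (Fin.cases i fun k => biproduct.ι (fun j => intervalRep K (d.kind j)) k ≫ d.iso.inv ≫ j)
    (Fin.cases ρ fun k => π ≫ d.iso.hom ≫ biproduct.π (fun j => intervalRep K (d.kind j)) k) ?_ ?_ ?_⟩
  · refine Fin.cases h fun k => ?_
    change (biproduct.ι (fun j => intervalRep K (d.kind j)) k ≫ d.iso.inv ≫ j) ≫ (π ≫ d.iso.hom ≫ biproduct.π (fun j => intervalRep K (d.kind j)) k) = 𝟙 _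
    simp [reassoc_of% hj]
  · refine Fin.cases (Fin.cases (fun h => absurd rfl h) fun k _ => ?_)
      fun k => Fin.cases (fun _ => ?_) fun l hkl => ?_
    · change i ≫ (π ≫ d.iso.hom ≫ biproduct.π (fun j => intervalRep K (d.kind j)) k) = 0
      simp [reassoc_of% hπ]
    · change (biproduct.ι (fun j => intervalRep K (d.kind j)) k ≫ d.iso.inv ≫ j) ≫ ρ = 0
      simp [hρ]
    · change (biproduct.ι (fun j => intervalRep K (d.kind j)) k ≫ d.iso.inv ≫ j) ≫ (π ≫ d.iso.hom ≫ biproduct.π (fun j => intervalRep K (d.kind j)) l) = 0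
      have : k ≠ l := fun h => hkl (by rw [h])
      simp [reassoc_of% hj, biproduct.ι_π_ne _ this]
  · rw [Fin.sum_univ_succ]
    change ρ ≫ i + ∑ k, (π ≫ d.iso.hom ≫ biproduct.π (fun j => intervalRep K (d.kind j)) k) ≫ (biproduct.ι (fun j => intervalRep K (d.kind j)) k ≫ d.iso.inv ≫ j) = _
    have : ∑ k, (π ≫ d.iso.hom ≫ biproduct.π (fun j => intervalRep K (d.kind j)) k) ≫ (biproduct.ι (fun j => intervalRep K (d.kind j)) k ≫ d.iso.inv ≫ j) =
        (π ≫ d.iso.hom) ≫ (∑ k, biproduct.π (fun j => intervalRep K (d.kind j)) k ≫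
          biproduct.ι (fun j => intervalRep K (d.kind j)) k) ≫ d.iso.inv ≫ j := by
      simp only [Preadditive.sum_comp, Preadditive.comp_sum, Category.assoc]
    rw [this, biproduct.total]
    simpa using ht

/-- A vector `x` of a space, as a map from `K`. -/
def vec {E : ModuleCat.{u} K} (x : E) : kk K ⟶ E :=
  ModuleCat.ofHom (LinearMap.toSpanSingleton K E x)

lemma vec_comp {E F : ModuleCat.{u} K} (x : E) (f : E ⟶ F) : vec x ≫ f = vec (f.hom x) := by
  ext; simp [vec]

lemma vec_zero {E : ModuleCat.{u} K} : vec (0 : E) = 0 := by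
  ext; simp [vec]

lemma vec_one : vec (1 : kk K) = 𝟙 (kk K) := by
  ext; simp [vec]

lemma exists_functional {E : ModuleCat.{u} K} (P : Submodule K E) (x : E) (hx : x ∉ P) :
    ∃ φ : E ⟶ kk K, φ.hom x = 1 ∧ ∀ y ∈ P, φ.hom y = 0 := by
  obtain ⟨f, hf, hP⟩ := Submodule.exists_le_ker_of_notMem hx
  refine ⟨ModuleCat.ofHom ((f x)⁻¹ • f), ?_, fun y hy => ?_⟩
  · simp [hf]
  · have : f y = 0 := hP hy
    simp [this]

lemma rep_hom_ext {f g : V ⟶ W} (h0 : f.app .zero = g.app .zero)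
    (h1 : f.app .left = g.app .left) (h2 : f.app .right = g.app .right) : f = g := by
  refine NatTrans.ext (funext ?_)
  rintro (_ | _ | _)
  exacts [h0, h1, h2]

lemma finite_intervalRep (I : Interval3) (v : WalkingSpan) :
    Module.Finite K ((intervalRep K I).obj v) := by
  have h0 : Module.Finite K (oo K) := inferInstanceAs (Module.Finite K PUnit.{u + 1})
  have h1 : Module.Finite K (kk K) := inferInstanceAs (Module.Finite K K)
  cases I <;> rcases v with _ | _ | _ <;> first | exact h0 | exact h1

lemma exists_nontrivial_intervalRep (I : Interval3) :
    ∃ v, Nontrivial ((intervalRep K I).obj v) := by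
  have h1 : Nontrivial (kk K) := inferInstanceAs (Nontrivial K)
  cases I
  exacts [⟨.left, h1⟩, ⟨.zero, h1⟩, ⟨.right, h1⟩, ⟨.zero, h1⟩, ⟨.zero, h1⟩, ⟨.zero, h1⟩]

lemma vec_comp_functional {E : ModuleCat.{u} K} (x : E) (φ : E ⟶ kk K) (h : φ.hom x = 1) :
    vec x ≫ φ = 𝟙 (kk K) := by
  rw [vec_comp, h, vec_one]

lemma exists_summand (V : Rep K) (v : WalkingSpan) (hv : Nontrivial (V.obj v)) :
    ∃ (I : Interval3) (i : intervalRep K I ⟶ V) (ρ : V ⟶ intervalRep K I), i ≫ ρ = 𝟙 _ := by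
  have ho := IntervalDecomposition.isZero_oo (K := K)
  set p : V.obj .zero ⟶ V.obj .left := V.map WalkingSpan.Hom.fst with hp
  set q : V.obj .zero ⟶ V.obj .right := V.map WalkingSpan.Hom.snd with hq
  by_cases hps : ∃ x : V.obj .left, x ∉ LinearMap.range p.hom
  · obtain ⟨x, hx⟩ := hps
    obtain ⟨φ, h1, hφ⟩ := exists_functional _ x hx
    refine ⟨.i11, spanHomMk (0 : oo K ⟶ _) (vec x : kk K ⟶ _) (0 : oo K ⟶ _)
      (ho.eq_of_src _ _) (ho.eq_of_src _ _),
      spanHomMk (0 : _ ⟶ oo K) (φ : _ ⟶ kk K) (0 : _ ⟶ oo K) ?_ (ho.eq_of_tgt _ _), ?_⟩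
    · change p ≫ φ = 0 ≫ (0 : oo K ⟶ kk K)
      ext y
      simpa using hφ _ (LinearMap.mem_range_self p.hom y)
    · exact rep_hom_ext (ho.eq_of_src _ _) (vec_comp_functional x φ h1) (ho.eq_of_src _ _)
  by_cases hqs : ∃ x : V.obj .right, x ∉ LinearMap.range q.hom
  · obtain ⟨x, hx⟩ := hqs
    obtain ⟨φ, h1, hφ⟩ := exists_functional _ x hx
    refine ⟨.i33, spanHomMk (0 : oo K ⟶ _) (0 : oo K ⟶ _) (vec x : kk K ⟶ _)
      (ho.eq_of_src _ _) (ho.eq_of_src _ _),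
      spanHomMk (0 : _ ⟶ oo K) (0 : _ ⟶ oo K) (φ : _ ⟶ kk K) (ho.eq_of_tgt _ _) ?_, ?_⟩
    · change q ≫ φ = 0 ≫ (0 : oo K ⟶ kk K)
      ext y
      simpa using hφ _ (LinearMap.mem_range_self q.hom y)
    · exact rep_hom_ext (ho.eq_of_src _ _) (ho.eq_of_src _ _) (vec_comp_functional x φ h1)
  push Not at hps hqs
  by_cases hz : ∃ z : V.obj .zero, z ≠ 0 ∧ p.hom z = 0 ∧ q.hom z = 0
  · obtain ⟨z, hz, hpz, hqz⟩ := hz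
    obtain ⟨φ, h1, -⟩ := exists_functional ⊥ z (by simpa using hz)
    refine ⟨.i22, spanHomMk (vec z : kk K ⟶ _) (0 : oo K ⟶ _) (0 : oo K ⟶ _) ?_ ?_,
      spanHomMk (φ : _ ⟶ kk K) (0 : _ ⟶ oo K) (0 : _ ⟶ oo K) (ho.eq_of_tgt _ _)
        (ho.eq_of_tgt _ _), ?_⟩
    · change (0 : kk K ⟶ oo K) ≫ 0 = vec z ≫ p
      rw [vec_comp, hpz, vec_zero, comp_zero]
    · change (0 : kk K ⟶ oo K) ≫ 0 = vec z ≫ q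
      rw [vec_comp, hqz, vec_zero, comp_zero]
    · exact rep_hom_ext (vec_comp_functional z φ h1) (ho.eq_of_src _ _) (ho.eq_of_src _ _)
  push Not at hz
  by_cases hpk : ∃ z : V.obj .zero, z ≠ 0 ∧ p.hom z = 0
  · obtain ⟨z, hz0, hpz⟩ := hpk
    obtain ⟨φ, h1, -⟩ := exists_functional ⊥ (q.hom z) (by simpa using hz z hz0 hpz)
    refine ⟨.i23, spanHomMk (vec z : kk K ⟶ _) (0 : oo K ⟶ _) (vec (q.hom z) : kk K ⟶ _) ?_ ?_,
      spanHomMk (q ≫ φ : _ ⟶ kk K) (0 : _ ⟶ oo K) (φ : _ ⟶ kk K) (ho.eq_of_tgt _ _) ?_, ?_⟩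
    · change (0 : kk K ⟶ oo K) ≫ 0 = vec z ≫ p
      rw [vec_comp, hpz, vec_zero, comp_zero]
    · change 𝟙 (kk K) ≫ vec (q.hom z) = vec z ≫ q
      rw [vec_comp, Category.id_comp]
    · change q ≫ φ = (q ≫ φ) ≫ 𝟙 (kk K)
      rw [Category.comp_id]
    · refine rep_hom_ext ?_ (ho.eq_of_src _ _) (vec_comp_functional _ φ h1)
      exact vec_comp_functional z (q ≫ φ) (by simpa using h1)
  by_cases hqk : ∃ z : V.obj .zero, z ≠ 0 ∧ q.hom z = 0
  · obtain ⟨z, hz0, hqz⟩ := hqk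
    obtain ⟨φ, h1, -⟩ := exists_functional ⊥ (p.hom z)
      (by simpa using fun h => hz z hz0 h hqz)
    refine ⟨.i12, spanHomMk (vec z : kk K ⟶ _) (vec (p.hom z) : kk K ⟶ _) (0 : oo K ⟶ _) ?_ ?_,
      spanHomMk (p ≫ φ : _ ⟶ kk K) (φ : _ ⟶ kk K) (0 : _ ⟶ oo K) ?_ (ho.eq_of_tgt _ _), ?_⟩
    · change 𝟙 (kk K) ≫ vec (p.hom z) = vec z ≫ p
      rw [vec_comp, Category.id_comp]
    · change (0 : kk K ⟶ oo K) ≫ 0 = vec z ≫ q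
      rw [vec_comp, hqz, vec_zero, comp_zero]
    · change p ≫ φ = (p ≫ φ) ≫ 𝟙 (kk K)
      rw [Category.comp_id]
    · refine rep_hom_ext ?_ (vec_comp_functional _ φ h1) (ho.eq_of_src _ _)
      exact vec_comp_functional z (p ≫ φ) (by simpa using h1)
  push Not at hpk hqk
  have hpi : Function.Injective p.hom :=
    (injective_iff_map_eq_zero p.hom).2 fun z h => by_contra fun h0 => hpk z h0 h
  have hqi : Function.Injective q.hom :=
    (injective_iff_map_eq_zero q.hom).2 fun z h => by_contra fun h0 => hqk z h0 h
  let ep := LinearEquiv.ofBijective p.hom ⟨hpi, hps⟩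
  let eq := LinearEquiv.ofBijective q.hom ⟨hqi, hqs⟩
  obtain ⟨z, hz0⟩ : ∃ z : V.obj .zero, z ≠ 0 := by
    obtain ⟨x, hx⟩ := exists_ne (0 : V.obj v)
    rcases v with _ | _ | _
    · exact ⟨x, hx⟩
    · obtain ⟨z, rfl⟩ := hps x
      exact ⟨z, fun h => hx (by rw [h, map_zero])⟩
    · obtain ⟨z, rfl⟩ := hqs x
      exact ⟨z, fun h => hx (by rw [h, map_zero])⟩
  obtain ⟨φ, h1, -⟩ := exists_functional ⊥ z (by simpa using hz0)
  have hep : ∀ y, ep.symm (p.hom y) = y := ep.symm_apply_apply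
  have heq : ∀ y, eq.symm (q.hom y) = y := eq.symm_apply_apply
  refine ⟨.i13, spanHomMk (vec z : kk K ⟶ _) (vec (p.hom z) : kk K ⟶ _)
      (vec (q.hom z) : kk K ⟶ _) ?_ ?_,
    spanHomMk (φ : _ ⟶ kk K) (ModuleCat.ofHom (φ.hom ∘ₗ ep.symm.toLinearMap) : _ ⟶ kk K)
      (ModuleCat.ofHom (φ.hom ∘ₗ eq.symm.toLinearMap) : _ ⟶ kk K) ?_ ?_, ?_⟩
  · change 𝟙 (kk K) ≫ vec (p.hom z) = vec z ≫ p
    rw [vec_comp, Category.id_comp]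
  · change 𝟙 (kk K) ≫ vec (q.hom z) = vec z ≫ q
    rw [vec_comp, Category.id_comp]
  · change p ≫ _ = φ ≫ 𝟙 (kk K)
    ext y
    simp [hep]
  · change q ≫ _ = φ ≫ 𝟙 (kk K)
    ext y
    simp [heq]
  · refine rep_hom_ext (vec_comp_functional z φ h1) (vec_comp_functional _ _ ?_)
      (vec_comp_functional _ _ ?_)
    · change φ.hom (ep.symm (p.hom z)) = 1
      rw [hep, h1]
    · change φ.hom (eq.symm (q.hom z)) = 1
      rw [heq, h1]

lemma nonempty_of_finite (N : ℕ) : ∀ (V : Rep K), (∀ v, Module.Finite K (V.obj v)) →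
    Module.finrank K (V.obj .left) + Module.finrank K (V.obj .zero) +
      Module.finrank K (V.obj .right) ≤ N → Nonempty (IntervalDecomposition V) := by
  induction N with
  | zero =>
    intro V hV hN
    have hz : ∀ v, Subsingleton (V.obj v) := by
      intro v
      have := hV v
      refine Module.finrank_zero_iff.1 (?_ : Module.finrank K (V.obj v) = 0)
      rcases v with _ | _ | _ <;> [change Module.finrank K (V.obj .zero) = 0;
        change Module.finrank K (V.obj .left) = 0; change Module.finrank K (V.obj .right) = 0] <;>
        omega
    refine ⟨IntervalDecomposition.ofTotal (N := 0) Fin.elim0 (fun j => j.elim0) (fun j => j.elim0)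
      (fun j => j.elim0) (fun j => j.elim0) ?_⟩
    refine NatTrans.ext (funext fun v => ?_)
    exact (ModuleCat.isZero_of_subsingleton (V.obj v)).eq_of_src _ _
  | succ N ih =>
    intro V hV hN
    by_cases hv : ∃ v, Nontrivial (V.obj v)
    · obtain ⟨v, hv⟩ := hv
      obtain ⟨I, i, ρ, h⟩ := exists_summand V v hv
      obtain ⟨W, j, π, hπ, hρ, hj, ht⟩ := exists_splitting i ρ h
      have hinj : ∀ v, Function.Injective (j.app v).hom := fun v x y hxy => by
        have := congrArg (fun f : W ⟶ W => (f.app v).hom) hj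
        have hx : ∀ x, (π.app v).hom ((j.app v).hom x) = x := fun x => by
          simpa using LinearMap.congr_fun this x
        rw [← hx x, hxy, hx]
      have hfin : ∀ v, Module.Finite K (W.obj v) := fun v => by
        have := hV v
        exact Module.Finite.of_injective _ (hinj v)
      have hle : ∀ v, Module.finrank K (W.obj v) ≤ Module.finrank K (V.obj v) := fun v => by
        have := hV v
        exact LinearMap.finrank_le_finrank_of_injective (hinj v)
      obtain ⟨w, hw⟩ := exists_nontrivial_intervalRep (K := K) I
      have hlt : Module.finrank K (W.obj w) < Module.finrank K (V.obj w) := by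
        refine lt_of_le_of_ne (hle w) fun he => ?_
        have := hV w
        have := hfin w
        have hs := (LinearMap.injective_iff_surjective_of_finrank_eq_finrank he).1 (hinj w)
        obtain ⟨x, hx⟩ := exists_ne (0 : (intervalRep K I).obj w)
        obtain ⟨y, hy⟩ := hs ((i.app w).hom x)
        have e1 := LinearMap.congr_fun (congrArg (fun f => (f.app w).hom) h) x
        have e2 := LinearMap.congr_fun (congrArg (fun f => (f.app w).hom) hρ) y
        apply hx
        calc x = (ρ.app w).hom ((i.app w).hom x) := by simpa using e1.symm
          _ = 0 := by rw [← hy]; simpa using e2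
      have hN' : Module.finrank K (W.obj .left) + Module.finrank K (W.obj .zero) +
          Module.finrank K (W.obj .right) ≤ N := by
        have a1 := hle .left
        have a2 := hle .zero
        have a3 := hle .right
        rcases w with _ | _ | _
        · change Module.finrank K (W.obj .zero) < Module.finrank K (V.obj .zero) at hlt
          omega
        · change Module.finrank K (W.obj .left) < Module.finrank K (V.obj .left) at hlt
          omega
        · change Module.finrank K (W.obj .right) < Module.finrank K (V.obj .right) at hlt
          omega
      obtain ⟨d⟩ := ih W hfin hN'
      exact nonempty_cons i ρ h j π hπ hρ hj ht d
    · push Not at hv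
      refine ih V hV ?_
      have : ∀ v, Module.finrank K (V.obj v) = 0 := fun v => by
        have := hv v
        exact Module.finrank_zero_of_subsingleton
      rw [this, this, this]
      exact Nat.zero_le _

end Existence

/-- A representation of `1 ← 2 → 3` has an indecomposable decomposition as above if and only if
its three spaces are finite-dimensional. -/
theorem nonempty_intervalDecomposition_iff (V : Rep K) :
    Nonempty (IntervalDecomposition V) ↔ ∀ v : WalkingSpan, Module.Finite K (V.obj v) := by
  refine ⟨?_, fun h => nonempty_of_finite _ V h le_rfl⟩
  rintro ⟨d⟩ v
  have := fun j => finite_intervalRep (K := K) (d.kind j) v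
  have hid : 𝟙 V = ∑ k, (d.iso.hom ≫ biproduct.π (fun j => intervalRep K (d.kind j)) k) ≫
      (biproduct.ι (fun j => intervalRep K (d.kind j)) k ≫ d.iso.inv) := by
    have : ∑ k, (d.iso.hom ≫ biproduct.π (fun j => intervalRep K (d.kind j)) k) ≫
        (biproduct.ι (fun j => intervalRep K (d.kind j)) k ≫ d.iso.inv) =
        d.iso.hom ≫ (∑ k, biproduct.π (fun j => intervalRep K (d.kind j)) k ≫
          biproduct.ι (fun j => intervalRep K (d.kind j)) k) ≫ d.iso.inv := by
      simp only [Preadditive.sum_comp, Preadditive.comp_sum, Category.assoc]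
    rw [this, biproduct.total]
    simp
  have hidv := congrArg (fun f => (f.app v).hom) hid
  refine Module.Finite.of_surjective (M := ∀ j, (intervalRep K (d.kind j)).obj v)
    (LinearMap.lsum K _ K fun j =>
      ((biproduct.ι (fun j => intervalRep K (d.kind j)) j ≫ d.iso.inv).app v).hom) fun x => ?_
  refine ⟨fun j => ((d.iso.hom ≫ biproduct.π (fun j => intervalRep K (d.kind j)) j).app v).hom x,
    ?_⟩
  have hx := LinearMap.congr_fun hidv x
  simp only [NatTrans.app_sum, ModuleCat.hom_sum, LinearMap.sum_apply] at hx
  rw [LinearMap.lsum_apply, LinearMap.sum_apply]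
  exact hx.symm

end Representations

/-! ### Homology -/

/-- Singular homology `H_k(-; K)` in degree `k` with coefficients in the field `K`. -/
def homology (K : Type u) [Field K] (k : ℕ) : TopCat.{0} ⥤ ModuleCat.{u} K :=
  (AlgebraicTopology.singularHomologyFunctor (ModuleCat.{u} K) k).obj (ModuleCat.of K K)

/-- Total singular homology `⨁ₖ H_k(-; K)`. -/
def totalHomology (K : Type u) [Field K] : TopCat.{0} ⥤ ModuleCat.{u} K :=
  ∐ fun k : ℕ => homology K k

/-! ### The filtration of a map -/

section Filtration

/-- The sublevel set `A_r = d_A⁻¹[0, r]` of the infimum distance `d_A` to `A`. It is empty for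
`r < 0`; the distance to the empty set is `∞`. -/
def sublevel {E : Type} [PseudoEMetricSpace E] (A : Set E) (r : ℝ) : Set E :=
  {x | 0 ≤ r ∧ Metric.infEDist x A ≤ ENNReal.ofReal r}

lemma sublevel_mono {E : Type} [PseudoEMetricSpace E] (A : Set E) {r s : ℝ} (h : r ≤ s) :
    sublevel A r ⊆ sublevel A s :=
  fun _ hx => ⟨hx.1.trans h, hx.2.trans (ENNReal.ofReal_le_ofReal h)⟩

variable {n : ℕ} {U : Set (EuclideanSpace ℝ (Fin n))}

/-- The graph of `h : U → ℝⁿ`, in the product `ℝⁿ × ℝⁿ` with the maximum of the two Euclidean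
distances as metric. -/
def graph (h : U → EuclideanSpace ℝ (Fin n)) :
    Set (EuclideanSpace ℝ (Fin n) × EuclideanSpace ℝ (Fin n)) :=
  Set.range fun x : U => ((x : EuclideanSpace ℝ (Fin n)), h x)

lemma fst_mem_sublevel (h : U → EuclideanSpace ℝ (Fin n)) {r : ℝ}
    {p : EuclideanSpace ℝ (Fin n) × EuclideanSpace ℝ (Fin n)} (hp : p ∈ sublevel (graph h) r) :
    p.1 ∈ sublevel U r := by
  refine ⟨hp.1, le_trans ?_ hp.2⟩
  refine Metric.le_infEDist.2 ?_
  rintro _ ⟨x, rfl⟩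
  exact (Metric.infEDist_le_edist_of_mem x.2).trans (by rw [Prod.edist_eq]; exact le_max_left _ _)

lemma snd_mem_sublevel (h : U → EuclideanSpace ℝ (Fin n)) {r : ℝ}
    {p : EuclideanSpace ℝ (Fin n) × EuclideanSpace ℝ (Fin n)} (hp : p ∈ sublevel (graph h) r) :
    p.2 ∈ sublevel (Set.range h) r := by
  refine ⟨hp.1, le_trans ?_ hp.2⟩
  refine Metric.le_infEDist.2 ?_
  rintro _ ⟨x, rfl⟩
  exact (Metric.infEDist_le_edist_of_mem (Set.mem_range_self x)).trans
    (by rw [Prod.edist_eq]; exact le_max_right _ _)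

/-- The inclusion of subspaces as a continuous map. -/
def inclusionMap {E : Type} [TopologicalSpace E] {A B : Set E} (h : A ⊆ B) :
    TopCat.of A ⟶ TopCat.of B :=
  TopCat.ofHom ⟨Set.inclusion h, continuous_inclusion h⟩

/-- The projection `Gr(h)_r → U_r`. -/
def projDomain (h : U → EuclideanSpace ℝ (Fin n)) (r : ℝ) :
    TopCat.of (sublevel (graph h) r) ⟶ TopCat.of (sublevel U r) :=
  TopCat.ofHom ⟨fun p => ⟨p.1.1, fst_mem_sublevel h p.2⟩, by fun_prop⟩

/-- The projection `Gr(h)_r → h(U)_r`. -/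
def projImage (h : U → EuclideanSpace ℝ (Fin n)) (r : ℝ) :
    TopCat.of (sublevel (graph h) r) ⟶ TopCat.of (sublevel (Set.range h) r) :=
  TopCat.ofHom ⟨fun p => ⟨p.1.2, snd_mem_sublevel h p.2⟩, by fun_prop⟩

/-- The filtration `{U_r ← Gr(h)_r → h(U)_r}` of diagrams of spaces, `r ∈ ℝ`, with the inclusions
as transition maps. -/
def spaceFiltration (h : U → EuclideanSpace ℝ (Fin n)) : ℝ ⥤ (WalkingSpan ⥤ TopCat.{0}) where
  obj r := span (projDomain h r) (projImage h r)
  map {r s} i := spanHomMk (inclusionMap (sublevel_mono _ (leOfHom i)))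
    (inclusionMap (sublevel_mono _ (leOfHom i))) (inclusionMap (sublevel_mono _ (leOfHom i)))
    rfl rfl
  map_id r := by
    ext (_ | _ | _) <;> rfl
  map_comp f g := by
    ext (_ | _ | _) <;> rfl

variable {K : Type u} [Field K]

/-- The family `{H U_r ← H Gr(h)_r → H h(U)_r}` of representations, `r ∈ ℝ`. -/
def repFiltration (H : TopCat.{0} ⥤ ModuleCat.{u} K) (h : U → EuclideanSpace ℝ (Fin n)) :
    ℝ ⥤ Rep K :=
  spaceFiltration h ⋙ (Functor.whiskeringRight _ _ _).obj H

/-- A choice of an indecomposable decomposition of `H U_r ← H Gr(h)_r → H h(U)_r` for every `r`.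
It exists if and only if all these homologies are finite-dimensional
(`nonempty_mapDecomposition_iff`), that is, if and only if the `ℝ`-persistence module of `h` is
defined. -/
abbrev MapDecomposition (H : TopCat.{0} ⥤ ModuleCat.{u} K) (h : U → EuclideanSpace ℝ (Fin n)) :
    Type u :=
  ∀ r : ℝ, IntervalDecomposition ((repFiltration H h).obj r)

/-- The `ℝ`-persistence module `M^h = {K^{m_{1,3}^r}}` of the map `h`: the summands
`𝕀[1, 3]^{m_{1,3}^r}` with the `([1, 3], [1, 3])`-blocks as transition maps, read off at one of the
three vertices (the maps between the vertices are isomorphisms). -/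
def mapModule {H : TopCat.{0} ⥤ ModuleCat.{u} K} {h : U → EuclideanSpace ℝ (Fin n)}
    (D : MapDecomposition H h) : ℝ ⥤ ModuleCat.{u} K where
  obj r := (D r).part13.obj WalkingSpan.zero
  map {r s} i := ((D r).block (D s) ((repFiltration H h).map i)).app WalkingSpan.zero
  map_id r := by
    rw [CategoryTheory.Functor.map_id, IntervalDecomposition.block_id]; rfl
  map_comp {r s t} i j := by
    rw [CategoryTheory.Functor.map_comp, IntervalDecomposition.block_comp _ (D s)]; rfl

theorem nonempty_mapDecomposition_iff (H : TopCat.{0} ⥤ ModuleCat.{u} K)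
    (h : U → EuclideanSpace ℝ (Fin n)) :
    Nonempty (MapDecomposition H h) ↔
      ∀ r : ℝ, Module.Finite K (H.obj (TopCat.of (sublevel U r))) ∧
        Module.Finite K (H.obj (TopCat.of (sublevel (graph h) r))) ∧
        Module.Finite K (H.obj (TopCat.of (sublevel (Set.range h) r))) := by
  rw [Classical.nonempty_pi]
  refine forall_congr' fun r => ?_
  rw [nonempty_intervalDecomposition_iff]
  constructor
  · exact fun hf => ⟨hf .left, hf .zero, hf .right⟩
  · rintro ⟨h1, h2, h3⟩ (_ | _ | _)
    exacts [h2, h1, h3]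

end Filtration

/-! ### Persistence modules, interleavings and diagrams -/

section Distances

variable {K : Type u} [Field K]

/-- The functor `t ↦ t + δ` of the poset `ℝ`; `shift δ ⋙ M` is the shifted module `M(δ)`. -/
def shift (δ : ℝ≥0) : ℝ ⥤ ℝ :=
  Monotone.functor (f := fun t : ℝ => t + δ) fun _ _ h => by simpa using h

/-- `M` and `N` are `δ`-interleaved: there are morphisms `f : M ⟶ N(δ)` and `g : N ⟶ M(δ)` such
that `g(δ) ∘ f` and `f(δ) ∘ g` are the `2δ`-transition morphisms of `M` and `N`. -/
def IsInterleaved (δ : ℝ≥0) (M N : ℝ ⥤ ModuleCat.{u} K) : Prop :=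
  ∃ (f : M ⟶ shift δ ⋙ N) (g : N ⟶ shift δ ⋙ M),
    (∀ t : ℝ, f.app t ≫ g.app (t + δ) =
      M.map (homOfLE (add_assoc t (δ : ℝ) δ ▸ le_add_of_nonneg_right (by positivity) :
        t ≤ t + δ + δ))) ∧
    ∀ t : ℝ, g.app t ≫ f.app (t + δ) =
      N.map (homOfLE (add_assoc t (δ : ℝ) δ ▸ le_add_of_nonneg_right (by positivity) :
        t ≤ t + δ + δ))

/-- The interleaving distance. -/
def interleavingDist (M N : ℝ ⥤ ModuleCat.{u} K) : ℝ≥0∞ :=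
  ⨅ (δ : ℝ≥0) (_ : IsInterleaved δ M N), (δ : ℝ≥0∞)

/-- A multiset of nonempty intervals of `ℝ`, given as an indexed family. -/
structure Barcode where
  /-- the index type -/
  ι : Type
  /-- the intervals -/
  I : ι → Set ℝ
  nonempty : ∀ i, (I i).Nonempty
  ordConnected : ∀ i, (I i).OrdConnected

namespace Barcode

open Classical in
variable (K) in
/-- The direct sum of the interval modules `K_I` over the intervals `I` of a barcode: the space at
`t` has the intervals that contain `t` as a basis (it consists of the finitely supported families
of scalars that vanish at the other intervals), and a transition map from `s` to `t` keeps the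
basis elements of the intervals that contain `t`, and kills the others. -/
def module (B : Barcode) : ℝ ⥤ ModuleCat.{u} K where
  obj t := ModuleCat.of K (Finsupp.supported K K {i | t ∈ B.I i})
  map {_ t} _ := ModuleCat.ofHom
    (Finsupp.restrictDom K K {i | t ∈ B.I i} ∘ₗ Submodule.subtype _)
  map_id t := by
    refine ModuleCat.hom_ext (LinearMap.ext fun x => Subtype.ext (Finsupp.ext fun i => ?_))
    by_cases hi : t ∈ B.I i
    · simp [Finsupp.restrictDom_apply, hi]
    · have := (Finsupp.mem_supported' _ _).1 x.2 i hi
      simp [Finsupp.restrictDom_apply, hi, this]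
  map_comp {r s t} f g := by
    refine ModuleCat.hom_ext (LinearMap.ext fun x => Subtype.ext (Finsupp.ext fun i => ?_))
    by_cases ht : t ∈ B.I i
    · by_cases hs : s ∈ B.I i
      · simp [Finsupp.restrictDom_apply, hs, ht]
      · have hr : r ∉ B.I i := fun hr =>
          hs ((B.ordConnected i).out hr ht ⟨leOfHom f, leOfHom g⟩)
        have := (Finsupp.mem_supported' _ _).1 x.2 i hr
        simp [Finsupp.restrictDom_apply, Finsupp.filter_apply, this]
    · simp [Finsupp.restrictDom_apply, ht]

/-- The left end (birth) of an interval of a barcode, in `[-∞, ∞]`. -/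
def birth (B : Barcode) (i : B.ι) : EReal := sInf ((fun t : ℝ => (t : EReal)) '' B.I i)

/-- The right end (death) of an interval of a barcode, in `[-∞, ∞]`. -/
def death (B : Barcode) (i : B.ι) : EReal := sSup ((fun t : ℝ => (t : EReal)) '' B.I i)

/-- `B` is the persistence diagram of `M`: the module `M` is isomorphic to the direct sum of the
interval modules of the intervals of `B`. -/
def IsDiagram (B : Barcode) (M : ℝ ⥤ ModuleCat.{u} K) : Prop :=
  Nonempty (M ≅ B.module K)

/-- There is a `δ`-matching of the points `(birth, death)` of two diagrams: a partial bijection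
such that matched points have distance at most `δ` in the maximum metric (infinite coordinates
are matched with equal ones only), and unmatched points have distance at most `δ` to the diagonal.
This amounts to a bijection once all points of the diagonal are added to the diagrams. -/
def IsMatched (δ : ℝ≥0) (B C : Barcode) : Prop :=
  ∃ σ : B.ι ≃. C.ι,
    (∀ i j, j ∈ σ i →
      B.birth i ≤ C.birth j + ((δ : ℝ) : EReal) ∧ C.birth j ≤ B.birth i + ((δ : ℝ) : EReal) ∧
      B.death i ≤ C.death j + ((δ : ℝ) : EReal) ∧ C.death j ≤ B.death i + ((δ : ℝ) : EReal)) ∧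
    (∀ i, σ i = none → B.death i ≤ B.birth i + ((2 * δ : ℝ) : EReal)) ∧
    ∀ j, σ.symm j = none → C.death j ≤ C.birth j + ((2 * δ : ℝ) : EReal)

/-- The bottleneck distance of persistence diagrams. -/
def bottleneckDist (B C : Barcode) : ℝ≥0∞ :=
  ⨅ (δ : ℝ≥0) (_ : IsMatched δ B C), (δ : ℝ≥0∞)

end Barcode

end Distances

end SampledMap

end

namespace SampledMap

universe u

/-! ### Interleavings of the filtrations of two maps -/

/-! Part (1). If the graphs have Hausdorff distance at most `δ`, then so have the domains and the
images, because the two projections do not increase distances. Each of the three sublevel sets of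
one map at `r` therefore lies in that of the other at `r + δ`. These inclusions interleave the two
filtrations of representations, and passing to the block at `([1, 3], [1, 3])` preserves composition
(`block_comp`): a composite `𝕀[1, 3] ⟶ 𝕀[b, d] ⟶ 𝕀[1, 3]` through any other interval vanishes. The
interleaving thus descends to the modules, whatever the decompositions (`isInterleaved_mapModule`).

Part (2) follows by algebraic stability (`isMatched_of_isInterleaved`). In the bases given by the
intervals, the interleaving morphisms become matrices `c` and `d`, and `c * d` has the entries of
the identity wherever the `2δ`-transition maps can see them (`isSection_coeff`). A nonzero entry
moves both ends of an interval to the left, up to the shift. If `c i j * d j k ≠ 0` and the `height`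
of `i` is at most that of `k`, then `j` has ends within `δ` of those of `i` or of `k`
(`near_or_near`). For finitely many intervals longer than `2δ`, with all their neighbours as middle
indices, the product is thus unitriangular with respect to the height. The rows of `c` are then
linearly independent, which is Hall's condition (`card_le`). Hall's theorem in both directions gives
two injections, and `exists_pequiv_of_injective` merges them into one matching. -/

lemma sublevel_subset {E : Type} [PseudoEMetricSpace E] {A B : Set E} {δ : ℝ≥0}
    (hd : Metric.hausdorffEDist A B ≤ δ) {r s : ℝ} (hs : r + δ ≤ s) :
    sublevel A r ⊆ sublevel B s := by
  rintro x ⟨hr, hx⟩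
  refine ⟨(add_nonneg hr δ.2).trans hs, ?_⟩
  calc Metric.infEDist x B ≤ Metric.infEDist x A + Metric.hausdorffEDist A B :=
        Metric.infEDist_le_infEDist_add_hausdorffEDist
    _ ≤ ENNReal.ofReal r + ENNReal.ofReal δ := by
        rw [ENNReal.ofReal_coe_nnreal]; exact add_le_add hx hd
    -- Membership in the sublevel set includes `0 ≤ r`; for negative `r`, `ENNReal.ofReal` need not
    -- be additive.
    _ = ENNReal.ofReal (r + δ) := (ENNReal.ofReal_add hr δ.2).symm
    _ ≤ ENNReal.ofReal s := ENNReal.ofReal_le_ofReal hs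

/-- A point of `B` close to `x` maps to a point at least as close to `p x`. The case of interest is
that of the two projections of a graph. -/
lemma hausdorffEDist_image_le {E F : Type} [PseudoEMetricSpace E] [PseudoEMetricSpace F]
    {p : E → F} (hp : ∀ x y, edist (p x) (p y) ≤ edist x y) (A B : Set E) :
    Metric.hausdorffEDist (p '' A) (p '' B) ≤ Metric.hausdorffEDist A B := by
  have aux : ∀ (A B : Set E), ∀ y ∈ p '' A,
      Metric.infEDist y (p '' B) ≤ Metric.hausdorffEDist A B := by
    rintro A B _ ⟨x, hx, rfl⟩
    refine le_trans ?_ (Metric.infEDist_le_hausdorffEDist_of_mem hx)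
    refine Metric.le_infEDist.2 fun z hz => ?_
    exact (Metric.infEDist_le_edist_of_mem (Set.mem_image_of_mem p hz)).trans (hp x z)
  refine Metric.hausdorffEDist_le_of_infEDist (aux A B) ?_
  rw [Metric.hausdorffEDist_comm]
  exact aux B A

section Maps

variable {n : ℕ} {U U' : Set (EuclideanSpace ℝ (Fin n))}

lemma fst_image_graph (h : U → EuclideanSpace ℝ (Fin n)) : Prod.fst '' graph h = U := by
  rw [graph, ← Set.range_comp]
  exact Subtype.range_coe

lemma snd_image_graph (h : U → EuclideanSpace ℝ (Fin n)) :
    Prod.snd '' graph h = Set.range h := by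
  rw [graph, ← Set.range_comp]
  rfl

lemma hausdorffEDist_domain_le (h : U → EuclideanSpace ℝ (Fin n))
    (h' : U' → EuclideanSpace ℝ (Fin n)) :
    Metric.hausdorffEDist U U' ≤ Metric.hausdorffEDist (graph h) (graph h') := by
  have := hausdorffEDist_image_le
    (p := (Prod.fst : EuclideanSpace ℝ (Fin n) × EuclideanSpace ℝ (Fin n) → _))
    (fun x y => by rw [Prod.edist_eq]; exact le_max_left _ _) (graph h) (graph h')
  rwa [fst_image_graph, fst_image_graph] at this

lemma hausdorffEDist_range_le (h : U → EuclideanSpace ℝ (Fin n))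
    (h' : U' → EuclideanSpace ℝ (Fin n)) :
    Metric.hausdorffEDist (Set.range h) (Set.range h') ≤
      Metric.hausdorffEDist (graph h) (graph h') := by
  have := hausdorffEDist_image_le
    (p := (Prod.snd : EuclideanSpace ℝ (Fin n) × EuclideanSpace ℝ (Fin n) → _))
    (fun x y => by rw [Prod.edist_eq]; exact le_max_right _ _) (graph h) (graph h')
  rwa [snd_image_graph, snd_image_graph] at this

/-- The morphism of diagrams of spaces given by the inclusions of the sublevel sets at `r` of one
map in the sublevel sets at `s` of another one. -/
def spaceInclusion {h : U → EuclideanSpace ℝ (Fin n)} {h' : U' → EuclideanSpace ℝ (Fin n)}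
    {δ : ℝ≥0} (hd : Metric.hausdorffEDist (graph h) (graph h') ≤ δ) {r s : ℝ} (hs : r + δ ≤ s) :
    (spaceFiltration h).obj r ⟶ (spaceFiltration h').obj s :=
  spanHomMk (inclusionMap (sublevel_subset hd hs))
    (inclusionMap (sublevel_subset ((hausdorffEDist_domain_le h h').trans hd) hs))
    (inclusionMap (sublevel_subset ((hausdorffEDist_range_le h h').trans hd) hs)) rfl rfl

variable {h : U → EuclideanSpace ℝ (Fin n)} {h' : U' → EuclideanSpace ℝ (Fin n)} {δ : ℝ≥0}

/-- All arrows here are inclusions of subspaces, so a composite depends only on its source and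
target. This and the next two lemmas provide the naturality and the triangle identities of the
interleaving. -/
lemma map_comp_spaceInclusion (hd : Metric.hausdorffEDist (graph h) (graph h') ≤ δ)
    {r s t : ℝ} (i : r ⟶ s) (hr : r + δ ≤ t) (hs : s + δ ≤ t) :
    (spaceFiltration h).map i ≫ spaceInclusion hd hs = spaceInclusion hd hr := by
  ext (_ | _ | _) <;> rfl

lemma spaceInclusion_comp_map (hd : Metric.hausdorffEDist (graph h) (graph h') ≤ δ)
    {r s t : ℝ} (i : s ⟶ t) (hs : r + δ ≤ s) (ht : r + δ ≤ t) :
    spaceInclusion hd hs ≫ (spaceFiltration h').map i = spaceInclusion hd ht := by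
  ext (_ | _ | _) <;> rfl

lemma spaceInclusion_comp (hd : Metric.hausdorffEDist (graph h) (graph h') ≤ δ)
    (hd' : Metric.hausdorffEDist (graph h') (graph h) ≤ δ)
    {r s t : ℝ} (i : r ⟶ t) (hs : r + δ ≤ s) (ht : s + δ ≤ t) :
    spaceInclusion hd hs ≫ spaceInclusion hd' ht = (spaceFiltration h).map i := by
  ext (_ | _ | _) <;> rfl

/-! ### Induced morphisms of persistence modules -/

variable {K : Type u} [Field K] {H : TopCat.{0} ⥤ ModuleCat.{u} K}

/-- The morphism of representations induced by `spaceInclusion`. -/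
noncomputable def repInclusion (H : TopCat.{0} ⥤ ModuleCat.{u} K)
    (hd : Metric.hausdorffEDist (graph h) (graph h') ≤ δ) {r s : ℝ} (hs : r + δ ≤ s) :
    (repFiltration H h).obj r ⟶ (repFiltration H h').obj s :=
  ((Functor.whiskeringRight _ _ _).obj H).map (spaceInclusion hd hs)

/-- The morphism `M^h ⟶ M^{h'}(δ)` of persistence modules induced by the inclusions. -/
noncomputable def mapModuleHom (D : MapDecomposition H h) (D' : MapDecomposition H h')
    (hd : Metric.hausdorffEDist (graph h) (graph h') ≤ δ) :
    mapModule D ⟶ shift δ ⋙ mapModule D' where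
  app r := ((D r).block (D' (r + δ)) (repInclusion H hd le_rfl)).app WalkingSpan.zero
  naturality r s i := by
    have hr : r + (δ : ℝ) ≤ s + δ := leOfHom ((shift δ).map i)
    have e : (repFiltration H h).map i ≫ repInclusion H hd (le_refl (s + (δ : ℝ))) =
        repInclusion H hd (le_refl (r + (δ : ℝ))) ≫
          (repFiltration H h').map (homOfLE hr) := by
      have e' := (map_comp_spaceInclusion hd i hr le_rfl).trans
        (spaceInclusion_comp_map hd (homOfLE hr) le_rfl hr).symm
      have := congrArg ((Functor.whiskeringRight _ _ _).obj H).map e'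
      rw [Functor.map_comp, Functor.map_comp] at this
      exact this
    have := congrArg ((D r).block (D' (s + δ))) e
    -- A block of a composite factors through any decomposition of the middle representation, so the
    -- ones chosen at `s` and at `r + δ` may be inserted.
    rw [IntervalDecomposition.block_comp _ (D s),
      IntervalDecomposition.block_comp _ (D' (r + δ))] at this
    exact congrArg (fun φ => NatTrans.app φ WalkingSpan.zero) this

lemma mapModuleHom_comp (D : MapDecomposition H h) (D' : MapDecomposition H h')
    (hd : Metric.hausdorffEDist (graph h) (graph h') ≤ δ)
    (hd' : Metric.hausdorffEDist (graph h') (graph h) ≤ δ) (t : ℝ) (i : t ⟶ t + δ + δ) :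
    (mapModuleHom D D' hd).app t ≫ (mapModuleHom D' D hd').app (t + δ) = (mapModule D).map i := by
  have e : repInclusion H hd (le_refl (t + (δ : ℝ))) ≫
      repInclusion H hd' (le_refl (t + δ + (δ : ℝ))) = (repFiltration H h).map i := by
    have := congrArg ((Functor.whiskeringRight _ _ _).obj H).map
      (spaceInclusion_comp hd hd' i le_rfl le_rfl)
    rw [Functor.map_comp] at this
    exact this
  have := congrArg ((D t).block (D (t + δ + δ))) e
  rw [IntervalDecomposition.block_comp _ (D' (t + δ))] at this
  exact congrArg (fun φ => NatTrans.app φ WalkingSpan.zero) this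

theorem isInterleaved_mapModule (D : MapDecomposition H h) (D' : MapDecomposition H h')
    (hd : Metric.hausdorffEDist (graph h) (graph h') ≤ δ) :
    IsInterleaved δ (mapModule D) (mapModule D') :=
  have hd' : Metric.hausdorffEDist (graph h') (graph h) ≤ δ := by
    rwa [Metric.hausdorffEDist_comm]
  ⟨mapModuleHom D D' hd, mapModuleHom D' D hd', fun t => mapModuleHom_comp D D' hd hd' t _,
    fun t => mapModuleHom_comp D' D hd' hd t _⟩

/-- An infinite bound is trivial, and a finite bound `b` is itself an admissible `δ`, so no limit
argument is needed. -/
lemma iInf_coe_le_of_forall {p : ℝ≥0 → Prop} {b : ℝ≥0∞} (hp : ∀ δ : ℝ≥0, b ≤ δ → p δ) :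
    ⨅ (δ : ℝ≥0) (_ : p δ), (δ : ℝ≥0∞) ≤ b := by
  induction b with
  | top => exact le_top
  | coe b => exact iInf₂_le b (hp b le_rfl)

/-- The space is a retract of the homology at the vertex `zero`. Pointwise finiteness is what
algebraic stability requires. -/
lemma finite_mapModule (D : MapDecomposition H h) (r : ℝ) :
    Module.Finite K ((mapModule D).obj r) := by
  have := (nonempty_intervalDecomposition_iff _).1 ⟨D r⟩ WalkingSpan.zero
  refine Module.Finite.of_surjective ((D r).proj.app WalkingSpan.zero).hom fun x =>
    ⟨((D r).incl.app WalkingSpan.zero).hom x, ?_⟩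
  have e := congrArg (fun φ => NatTrans.app φ WalkingSpan.zero) (D r).incl_proj
  exact LinearMap.congr_fun (congrArg ModuleCat.Hom.hom e) x

end Maps

/-! ### Gluing two matchings -/

lemma exists_pequiv_of_relation {α β : Type*} (R : α → β → Prop)
    (h1 : ∀ i j j', R i j → R i j' → j = j') (h2 : ∀ i i' j, R i j → R i' j → i = i') :
    ∃ σ : α ≃. β, (∀ i j, j ∈ σ i ↔ R i j) := by
  classical
  refine ⟨⟨fun i => if h : ∃ j, R i j then some h.choose else none,
    fun j => if h : ∃ i, R i j then some h.choose else none, fun i j => ?_⟩, fun i j => ?_⟩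
  · have e1 : (i ∈ if h : ∃ i, R i j then some h.choose else none) ↔ R i j := by
      split_ifs with h
      · rw [Option.mem_some_iff]
        exact ⟨fun e => e ▸ h.choose_spec, fun hr => h2 _ _ _ h.choose_spec hr⟩
      · exact ⟨fun e => absurd e (by simp), fun hr => absurd ⟨i, hr⟩ h⟩
    have e2 : (j ∈ if h : ∃ j, R i j then some h.choose else none) ↔ R i j := by
      split_ifs with h
      · rw [Option.mem_some_iff]
        exact ⟨fun e => e ▸ h.choose_spec, fun hr => h1 _ _ _ h.choose_spec hr⟩
      · exact ⟨fun e => absurd e (by simp), fun hr => absurd ⟨j, hr⟩ h⟩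
    exact e1.trans e2.symm
  · change (j ∈ if h : ∃ j, R i j then some h.choose else none) ↔ R i j
    split_ifs with h
    · rw [Option.mem_some_iff]
      exact ⟨fun e => e ▸ h.choose_spec, fun hr => h1 _ _ _ h.choose_spec hr⟩
    · exact ⟨fun e => absurd e (by simp), fun hr => absurd ⟨j, hr⟩ h⟩

/-- If `p` can be matched into `β` and `q` can be matched into `α`, then there is a partial
bijection between `α` and `β` that covers both `p` and `q` (Mendelsohn–Dulmage). -/
lemma exists_pequiv_of_injective {α β : Type*} {p : α → Prop} {q : β → Prop}
    (R : α → β → Prop) (φ : {i // p i} → β) (hφ : Function.Injective φ) (hR : ∀ i : {i // p i}, R i (φ i))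
    (ψ : {j // q j} → α) (hψ : Function.Injective ψ) (hR' : ∀ j : {j // q j}, R (ψ j) j) :
    ∃ σ : α ≃. β, (∀ i j, j ∈ σ i → R i j) ∧ (∀ i, σ i = none → ¬ p i) ∧
      ∀ j, σ.symm j = none → ¬ q j := by
  -- As in the Schröder–Bernstein theorem: given a fixed point `X` of `F`, the elements of `X` are
  -- matched by `φ`, and the elements of `q` outside `φ(X)` by `ψ`. The fixed point equation says
  -- that `X` consists of the elements of `p` that this part of `ψ` misses, so the two rules never
  -- conflict and together cover `p` and `q`.
  let F : Set α →o Set α :=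
    ⟨fun X => {i | p i ∧ ¬ ∃ j : {j // q j}, ψ j = i ∧ ¬ ∃ k : {i // p i}, k.1 ∈ X ∧ φ k = j},
      fun X Y hXY i hi => ⟨hi.1, fun ⟨j, hj, hk⟩ => hi.2 ⟨j, hj, fun ⟨k, hkX, e⟩ =>
        hk ⟨k, hXY hkX, e⟩⟩⟩⟩
  obtain ⟨X, hX⟩ : ∃ X, F X = X := ⟨F.lfp, F.map_lfp⟩
  have hXi : ∀ i, i ∈ X ↔
      p i ∧ ¬ ∃ j : {j // q j}, ψ j = i ∧ ¬ ∃ k : {i // p i}, k.1 ∈ X ∧ φ k = j := fun i =>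
    (Set.ext_iff.1 hX i).symm
  let T : α → β → Prop := fun i j => (∃ k : {i // p i}, k.1 = i ∧ i ∈ X ∧ φ k = j) ∨
    ∃ l : {j // q j}, l.1 = j ∧ ψ l = i ∧ ¬ ∃ k : {i // p i}, k.1 ∈ X ∧ φ k = l
  obtain ⟨σ, hσ⟩ := exists_pequiv_of_relation T
    (by
      rintro i j j' (⟨k, rfl, hk, rfl⟩ | ⟨l, rfl, rfl, hl⟩) (⟨k', hk', hkX', rfl⟩ | ⟨l', rfl, hl', hn⟩)
      · rw [Subtype.ext hk']
      · exact absurd ⟨l', hl', hn⟩ ((hXi _).1 hk).2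
      · exact absurd ⟨l, rfl, hl⟩ ((hXi _).1 hkX').2
      · rw [hψ hl'])
    (by
      rintro i i' j (⟨k, rfl, hk, rfl⟩ | ⟨l, rfl, rfl, hl⟩) (⟨k', rfl, hk', e⟩ | ⟨l', e, rfl, hn⟩)
      · rw [hφ e]
      · exact absurd ⟨k, hk, e.symm⟩ hn
      · exact absurd ⟨k', hk', e⟩ hl
      · rw [Subtype.ext e])
  refine ⟨σ, fun i j hj => ?_, fun i hi hp => ?_, fun j hj hq => ?_⟩
  · rcases (hσ i j).1 hj with ⟨k, rfl, -, rfl⟩ | ⟨l, rfl, rfl, -⟩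
    exacts [hR k, hR' l]
  · by_cases hiX : i ∈ X
    · have := (hσ i (φ ⟨i, hp⟩)).2 (Or.inl ⟨⟨i, hp⟩, rfl, hiX, rfl⟩)
      simp [hi] at this
    · rw [hXi] at hiX
      have hc := fun h => hiX ⟨hp, h⟩
      obtain ⟨l, rfl, hl⟩ := not_not.1 hc
      have := (hσ (ψ l) l).2 (Or.inr ⟨l, rfl, rfl, hl⟩)
      simp [hi] at this
  · have key : ∀ i, ¬ T i j := fun i hT => by
      have := (σ.mem_iff_mem (a := i) (b := j)).2 ((hσ i j).2 hT)
      simp [hj] at this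
    by_cases hk : ∃ k : {i // p i}, k.1 ∈ X ∧ φ k = j
    · obtain ⟨k, hkX, rfl⟩ := hk
      exact key k (Or.inl ⟨k, rfl, hkX, rfl⟩)
    · exact key (ψ ⟨j, hq⟩) (Or.inr ⟨⟨j, hq⟩, rfl, rfl, hk⟩)

namespace Barcode

/-! ### Births, deaths and the order of intervals -/

section Endpoints

variable {B C : Barcode} {δ : ℝ≥0}

lemma add_two_mul (x : EReal) (δ : ℝ) : x + ((2 * δ : ℝ) : EReal) = x + (δ : EReal) + (δ : EReal) := by
  rw [two_mul, EReal.coe_add, add_assoc]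

lemma lt_of_add_coe_lt {x y : EReal} {a : ℝ} (h : x + (a : EReal) < y + (a : EReal)) : x < y := by
  by_contra! hxy
  exact absurd h (not_lt.2 (by gcongr))

lemma birth_le {i : B.ι} {t : ℝ} (h : t ∈ B.I i) : B.birth i ≤ t :=
  sInf_le (Set.mem_image_of_mem _ h)

lemma le_death {i : B.ι} {t : ℝ} (h : t ∈ B.I i) : (t : EReal) ≤ B.death i :=
  le_sSup (Set.mem_image_of_mem _ h)

lemma birth_ne_top (i : B.ι) : B.birth i ≠ ⊤ := by
  obtain ⟨t, ht⟩ := B.nonempty i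
  exact ((birth_le ht).trans_lt (EReal.coe_lt_top t)).ne

lemma death_ne_bot (i : B.ι) : B.death i ≠ ⊥ := by
  obtain ⟨t, ht⟩ := B.nonempty i
  exact ((EReal.bot_lt_coe t).trans_le (le_death ht)).ne'

/-- The inequalities are strict because an interval need not contain its ends. -/
lemma mem_of_lt {i : B.ι} {t : ℝ} (h1 : B.birth i < t) (h2 : (t : EReal) < B.death i) :
    t ∈ B.I i := by
  obtain ⟨_, ⟨s, hs, rfl⟩, hst⟩ := sInf_lt_iff.1 h1
  obtain ⟨_, ⟨s', hs', rfl⟩, hst'⟩ := lt_sSup_iff.1 h2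
  exact (B.ordConnected i).out hs hs' ⟨(EReal.coe_lt_coe_iff.1 hst).le,
    (EReal.coe_lt_coe_iff.1 hst').le⟩

lemma exists_mem_of_birth_add_lt_death {i : B.ι}
    (h : B.birth i + ((2 * δ : ℝ) : EReal) < B.death i) :
    ∃ s ∈ B.I i, ∃ s' ∈ B.I i, s + 2 * δ < s' := by
  obtain ⟨_, ⟨s', hs', rfl⟩, h'⟩ := lt_sSup_iff.1 h
  have : B.birth i < ((s' - 2 * δ : ℝ) : EReal) := by
    refine lt_of_add_coe_lt (a := 2 * δ) ?_
    rw [← EReal.coe_add, sub_add_cancel]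
    exact h'
  obtain ⟨_, ⟨s, hs, rfl⟩, hss⟩ := sInf_lt_iff.1 this
  exact ⟨s, hs, s', hs', by have := EReal.coe_lt_coe_iff.1 hss; linarith⟩

/-- The intervals have ends at distance at most `δ`. -/
def Near (δ : ℝ≥0) (B C : Barcode) (i : B.ι) (j : C.ι) : Prop :=
  B.birth i ≤ C.birth j + ((δ : ℝ) : EReal) ∧ C.birth j ≤ B.birth i + ((δ : ℝ) : EReal) ∧
    B.death i ≤ C.death j + ((δ : ℝ) : EReal) ∧ C.death j ≤ B.death i + ((δ : ℝ) : EReal)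

lemma Near.symm {i : B.ι} {j : C.ι} (h : Near δ B C i j) : Near δ C B j i :=
  ⟨h.2.1, h.1, h.2.2.2, h.2.2.1⟩

/-- The midpoint has distance more than `δ` from `s` and `s'`, hence from both ends of `i`, so it
survives moving the ends by `δ`. -/
lemma Near.mem {i : B.ι} {j : C.ι} (h : Near δ B C i j) {s s' : ℝ} (hs : s ∈ B.I i)
    (hs' : s' ∈ B.I i) (hss : s + 2 * δ < s') : (s + s') / 2 ∈ C.I j := by
  refine mem_of_lt (h.2.1.trans_lt ?_) ?_
  · refine (add_le_add_left (birth_le hs) _).trans_lt ?_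
    rw [← EReal.coe_add, EReal.coe_lt_coe_iff]
    linarith
  · refine lt_of_add_coe_lt (a := δ) (lt_of_lt_of_le ?_ ((le_death hs').trans h.2.2.1))
    rw [← EReal.coe_add, EReal.coe_lt_coe_iff]
    linarith

/-- There is a nonzero morphism from the module of the interval `i` to the `δ`-shifted module of
the interval `j`. -/
def Precedes (δ : ℝ≥0) (B C : Barcode) (i : B.ι) (j : C.ι) : Prop :=
  ∃ t ∈ B.I i, t + δ ∈ C.I j ∧ (∀ s ≤ t, s ∈ B.I i → s + δ ∈ C.I j) ∧
    ∀ s ≥ t, s + δ ∈ C.I j → s ∈ B.I i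

/-- A nonzero morphism takes generators to generators, so `j` is alive once `i` is born, up to the
shift. Dually, `j` cannot outlive `i`, as `death_le` states. -/
lemma Precedes.birth_le {i : B.ι} {j : C.ι} (h : Precedes δ B C i j) :
    C.birth j ≤ B.birth i + ((δ : ℝ) : EReal) := by
  obtain ⟨t, ht, htj, h1, -⟩ := h
  rw [← EReal.sub_le_iff_le_add (Or.inl (EReal.coe_ne_bot _)) (Or.inl (EReal.coe_ne_top _))]
  refine le_sInf ?_
  rintro _ ⟨s, hs, rfl⟩
  rw [EReal.sub_le_iff_le_add (Or.inl (EReal.coe_ne_bot _)) (Or.inl (EReal.coe_ne_top _)),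
    ← EReal.coe_add]
  rcases le_total s t with hst | hst
  · exact Barcode.birth_le (h1 s hst hs)
  · refine (Barcode.birth_le htj).trans (EReal.coe_le_coe_iff.2 ?_)
    linarith

lemma Precedes.death_le {i : B.ι} {j : C.ι} (h : Precedes δ B C i j) :
    C.death j ≤ B.death i + ((δ : ℝ) : EReal) := by
  obtain ⟨t, ht, htj, -, h2⟩ := h
  refine sSup_le ?_
  rintro _ ⟨s, hs, rfl⟩
  have e : (s : EReal) = ((s - δ : ℝ) : EReal) + ((δ : ℝ) : EReal) := by
    rw [← EReal.coe_add, sub_add_cancel]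
  dsimp only
  rw [e]
  refine add_le_add_left ?_ _
  rcases le_total t (s - δ) with hst | hst
  · exact le_death (h2 _ hst (by simpa using hs))
  · exact (EReal.coe_le_coe_iff.2 hst).trans (le_death ht)

/-- A product of nonzero entries `i → j → k` is visible at every `t` at which the outer two
intervals are alive, so no term is lost when the matrix product is read off at a single `t`. -/
lemma Precedes.mem {i k : B.ι} {j : C.ι} (h : Precedes δ B C i j) (h' : Precedes δ C B j k)
    {t : ℝ} (hi : t ∈ B.I i) (hk : t + δ + δ ∈ B.I k) : t + δ ∈ C.I j := by
  obtain ⟨s, -, hsj, h1, -⟩ := h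
  obtain ⟨r, hrj, -, -, h2⟩ := h'
  rcases le_total t s with hts | hts
  · exact h1 t hts hi
  rcases le_total r (t + δ) with hrt | hrt
  · exact h2 _ hrt hk
  · exact (C.ordConnected j).out hsj hrj ⟨by linarith, hrt⟩

open Classical in
/-- Intervals with ends `b` and `d` are compared by the number of finite left ends plus the number of
infinite right ends, and then by the sum of the finite ends. It decreases along a morphism that is
far from an isomorphism (`height_lt`). -/
noncomputable def height (b d : EReal) : ℕ ×ₗ ℝ :=
  toLex ((if b = ⊥ then 0 else 1) + (if d = ⊤ then 1 else 0), b.toReal + d.toReal)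

/-- If `b` is finite then `b' ≠ ⊥`, and if `d = ⊤` then `d' = ⊤`, so the first component cannot drop
from `(b, d)` to `(b', d')`. If it stays equal, the same ends are infinite and contribute `0` to the
sums. The finite ends then decide: adding, for instance, `b + a < b'` and `d ≤ d' + a` cancels `a`.
-/
lemma height_lt {b d b' d' : EReal} {a : ℝ} (hb : b ≠ ⊤) (hb' : b' ≠ ⊤) (hd : d ≠ ⊥)
    (hd' : d' ≠ ⊥) (h1 : b ≤ b' + a) (h2 : d ≤ d' + a)
    (h : b + a < b' ∨ d + a < d' ∨ b < b' ∧ d < d') : height b d < height b' d' := by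
  rw [height, height, Prod.Lex.toLex_lt_toLex]
  induction b <;> induction b' <;> induction d <;> induction d' <;> norm_cast at h h1 h2 <;>
    simp_all
  all_goals first | done | grind

lemma exists_mem_add_mem {i k : B.ι} {a : ℝ} (ha : 0 ≤ a)
    (hi : B.birth i + a < B.death i) (hk : B.birth k + a < B.death k)
    (hb : B.birth k ≤ B.birth i + a) (hd : B.death k ≤ B.death i + a)
    (hik : height (B.birth i) (B.death i) ≤ height (B.birth k) (B.death k)) :
    ∃ t ∈ B.I i, t + a ∈ B.I k := by
  -- Otherwise `k`, being longer than `a`, would be born before `i` and die before `i`, against the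
  -- order of heights.
  have hlt : B.birth i + a < B.death k := by
    by_contra! h
    refine absurd hik (not_le.2 (height_lt (birth_ne_top k) (birth_ne_top i) (death_ne_bot k)
      (death_ne_bot i) hb hd (Or.inr (Or.inr ⟨?_, h.trans_lt hi⟩))))
    exact lt_of_add_coe_lt (hk.trans_le h)
  have hle : ∀ x : EReal, x ≤ x + a := fun x => le_add_of_nonneg_right (EReal.coe_nonneg.2 ha)
  obtain ⟨t, ht1, ht2⟩ : ∃ t : ℝ, max (B.birth i + a) (B.birth k) < t ∧
      (t : EReal) < min (B.death i + a) (B.death k) := by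
    refine EReal.lt_iff_exists_real_btwn.1 (max_lt (lt_min ?_ hlt) (lt_min ?_ ?_))
    · exact hi.trans_le (hle _)
    · exact hb.trans_lt (hi.trans_le (hle _))
    · exact (hle _).trans_lt hk
  have e : (t : EReal) = ((t - a : ℝ) : EReal) + (a : EReal) := by
    rw [← EReal.coe_add, sub_add_cancel]
  refine ⟨t - a, mem_of_lt ?_ ?_, ?_⟩
  · exact lt_of_add_coe_lt (e ▸ (le_max_left _ _).trans_lt ht1)
  · exact lt_of_add_coe_lt (e ▸ ht2.trans_le (min_le_left _ _))
  · rw [sub_add_cancel]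
    exact mem_of_lt ((le_max_right _ _).trans_lt ht1) (ht2.trans_le (min_le_right _ _))

/-- If both steps fail to be near, each moves some end to the left by an excess. With the same end
twice, that end moves by more than `2δ` in total; with different ends, both ends of `k` lie strictly
before those of `i`. Either way the height of `k` is smaller than that of `i`. -/
lemma Precedes.near_or_near {i k : B.ι} {j : C.ι} (h : Precedes δ B C i j)
    (h' : Precedes δ C B j k)
    (hik : height (B.birth i) (B.death i) ≤ height (B.birth k) (B.death k)) :
    Near δ B C i j ∨ Near δ B C k j := by
  by_contra! hn
  have hb := h.birth_le
  have hd := h.death_le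
  have hb' := h'.birth_le
  have hd' := h'.death_le
  have h1 : C.birth j + ((δ : ℝ) : EReal) < B.birth i ∨
      C.death j + ((δ : ℝ) : EReal) < B.death i := by
    by_contra! hc
    exact hn.1 ⟨hc.1, hb, hc.2, hd⟩
  have h2 : B.birth k + ((δ : ℝ) : EReal) < C.birth j ∨
      B.death k + ((δ : ℝ) : EReal) < C.death j := by
    by_contra! hc
    exact hn.2 ⟨hb', hc.1, hd', hc.2⟩
  refine absurd hik (not_le.2 (height_lt (a := 2 * δ) (birth_ne_top k) (birth_ne_top i)
    (death_ne_bot k) (death_ne_bot i) ?_ ?_ ?_))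
  · rw [add_two_mul]
    exact hb'.trans (add_le_add_left hb _)
  · rw [add_two_mul]
    exact hd'.trans (add_le_add_left hd _)
  · rw [add_two_mul, add_two_mul]
    rcases h1 with h1 | h1 <;> rcases h2 with h2 | h2
    · exact Or.inl ((add_le_add_left h2.le _).trans_lt h1)
    · exact Or.inr (Or.inr ⟨hb'.trans_lt h1, lt_of_add_coe_lt (h2.trans_le hd)⟩)
    · exact Or.inr (Or.inr ⟨lt_of_add_coe_lt (h2.trans_le hb), hd'.trans_lt h1⟩)
    · exact Or.inr (Or.inl ((add_le_add_left h2.le _).trans_lt h1))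

end Endpoints

/-! ### Hall's condition -/

section Hall

variable {K : Type u} [Field K] {B C : Barcode} {δ : ℝ≥0}

/-- The intervals of length greater than `2δ`. -/
def IsLong (δ : ℝ≥0) (B : Barcode) (i : B.ι) : Prop :=
  B.birth i + ((2 * δ : ℝ) : EReal) < B.death i

/-- The matrices `c` and `d` satisfy the relations of the matrices of two morphisms of direct sums
of interval modules, of degree `δ`, whose composition is the transition morphism. -/
structure IsSection (δ : ℝ≥0) (c : B.ι → C.ι → K) (d : C.ι → B.ι → K) : Prop where
  precedes_left : ∀ i j, c i j ≠ 0 → Precedes δ B C i j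
  precedes_right : ∀ j k, d j k ≠ 0 → Precedes δ C B j k
  sum_eq : ∀ i k t, t ∈ B.I i → t + δ + δ ∈ B.I k → ∀ N : Finset C.ι,
    (∀ j ∉ N, c i j * d j k = 0) → ∑ j ∈ N, c i j * d j k = Finsupp.single i (1 : K) k

variable {c : B.ι → C.ι → K} {d : C.ι → B.ι → K}

/-- The height condition confines the nonzero terms to neighbours of `i` or `k`, so a finite `N`
suffices. This is the unitriangularity of the product; nothing is claimed for the opposite order of
heights. -/
lemma IsSection.sum_mul_eq (h : IsSection δ c d) {i k : B.ι} (hi : IsLong δ B i)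
    (hk : IsLong δ B k)
    (hik : height (B.birth i) (B.death i) ≤ height (B.birth k) (B.death k)) (N : Finset C.ι)
    (hNi : ∀ j, Near δ B C i j → j ∈ N) (hNk : ∀ j, Near δ B C k j → j ∈ N) :
    ∑ j ∈ N, c i j * d j k = Finsupp.single i (1 : K) k := by
  have hN : ∀ j ∉ N, c i j * d j k = 0 := by
    intro j hj
    by_contra! h0
    rcases (h.precedes_left i j (left_ne_zero_of_mul h0)).near_or_near
      (h.precedes_right j k (right_ne_zero_of_mul h0)) hik with hn | hn
    exacts [hj (hNi j hn), hj (hNk j hn)]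
  by_cases ht : ∃ t ∈ B.I i, t + δ + δ ∈ B.I k
  · obtain ⟨t, hti, htk⟩ := ht
    exact h.sum_eq i k t hti htk N hN
  -- The transition map gives no information on this entry. Here `i ≠ k`, since a long interval
  -- meets its own shift by `2δ`, and one nonzero term would already produce an excluded `t`.
  · have hne : i ≠ k := by
      rintro rfl
      obtain ⟨s, hs, s', hs', hss⟩ := exists_mem_of_birth_add_lt_death hi
      have := δ.2
      exact ht ⟨s, hs, (B.ordConnected i).out hs hs' ⟨by linarith, by linarith⟩⟩
    rw [Finsupp.single_eq_of_ne' hne]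
    refine Finset.sum_eq_zero fun j _ => ?_
    by_contra! h0
    have hij := h.precedes_left i j (left_ne_zero_of_mul h0)
    have hjk := h.precedes_right j k (right_ne_zero_of_mul h0)
    obtain ⟨t, hti, htk⟩ := exists_mem_add_mem (a := 2 * δ) (by positivity) hi hk
      (by rw [add_two_mul]; exact hjk.birth_le.trans (add_le_add_left hij.birth_le _))
      (by rw [add_two_mul]; exact hjk.death_le.trans (add_le_add_left hij.death_le _)) hik
    exact ht ⟨t, hti, by rwa [add_assoc, ← two_mul]⟩

/-- The rows of `c` indexed by `s`, restricted to the columns in `N`, are linearly independent, so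
there are at most `N.card` of them. -/
lemma IsSection.card_le (h : IsSection δ c d) (s : Finset B.ι) (hs : ∀ i ∈ s, IsLong δ B i)
    (N : Finset C.ι) (hN : ∀ i ∈ s, ∀ j, Near δ B C i j → j ∈ N) : s.card ≤ N.card := by
  classical
  have hli : LinearIndependent K fun (i : s) (j : N) => c i j := by
    rw [Fintype.linearIndependent_iff]
    intro x hx
    by_contra! hne
    obtain ⟨i₀, hi₀⟩ := hne
    -- Choosing `k` of maximal height in the support of the relation makes `sum_mul_eq` applicable
    -- to every row that occurs; pairing the relation with column `k` of `d` then leaves only `x k`.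
    obtain ⟨k, hk, hmax⟩ := Finset.exists_max_image (Finset.univ.filter fun i => x i ≠ 0)
      (fun i : s => height (B.birth i) (B.death i)) ⟨i₀, by simpa using hi₀⟩
    have hk0 : x k ≠ 0 := (Finset.mem_filter.1 hk).2
    have e : ∑ j : N, (∑ i, x i * c i j) * d j k = 0 := by
      refine Finset.sum_eq_zero fun j _ => ?_
      have := congrFun hx j
      rw [Finset.sum_apply] at this
      simp only [Pi.smul_apply, smul_eq_mul, Pi.zero_apply] at this
      rw [this, zero_mul]
    simp only [Finset.sum_mul] at e
    rw [Finset.sum_comm] at e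
    have e' : ∀ i : s, ∑ j : N, x i * c i j * d j k = if i = k then x i else 0 := by
      intro i
      by_cases hi : x i = 0
      · simp [hi]
      · have := h.sum_mul_eq (hs i i.2) (hs k k.2) (hmax i (by simpa using hi)) N (hN i i.2)
          (hN k k.2)
        rw [← Finset.sum_coe_sort] at this
        simp only [mul_assoc]
        rw [← Finset.mul_sum, this, Finsupp.single_apply]
        by_cases hik : i = k
        · simp [hik]
        · simp [hik, Subtype.coe_injective.ne hik]
    simp only [e', Finset.sum_ite_eq', Finset.mem_univ, if_true] at e
    exact hk0 e
  simpa using hli.fintype_card_le_finrank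

/-- By `Near.mem`, all neighbours contain one common point. This finiteness is what allows Hall's
theorem for an infinite family. -/
lemma finite_setOf_near (hC : ∀ t, {j | t ∈ C.I j}.Finite) {i : B.ι} (hi : IsLong δ B i) :
    {j | Near δ B C i j}.Finite := by
  obtain ⟨s, hs, s', hs', hss⟩ := exists_mem_of_birth_add_lt_death hi
  exact (hC ((s + s') / 2)).subset fun j hj => hj.mem hs hs' hss

lemma IsSection.exists_injective (h : IsSection δ c d) (hC : ∀ t, {j | t ∈ C.I j}.Finite) :
    ∃ φ : {i // IsLong δ B i} → C.ι, Function.Injective φ ∧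
      ∀ i : {i // IsLong δ B i}, Near δ B C i (φ i) := by
  classical
  obtain ⟨φ, hφ, hφt⟩ := (Finset.all_card_le_biUnion_card_iff_exists_injective
    fun i : {i // IsLong δ B i} => (finite_setOf_near hC i.2).toFinset).1 fun s => by
      refine le_of_eq_of_le (Finset.card_map (Function.Embedding.subtype _)).symm
        (h.card_le (s.map (Function.Embedding.subtype _)) ?_ _ ?_)
      · intro i hi
        obtain ⟨i, -, rfl⟩ := Finset.mem_map.1 hi
        exact i.2
      · intro i hi j hj
        obtain ⟨i, his, rfl⟩ := Finset.mem_map.1 hi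
        exact Finset.mem_biUnion.2 ⟨i, his, by simpa using hj⟩
  exact ⟨φ, hφ, fun i => by simpa using hφt i⟩

lemma isMatched_of_isSection (h : IsSection δ c d) (h' : IsSection δ d c)
    (hB : ∀ t, {i | t ∈ B.I i}.Finite) (hC : ∀ t, {j | t ∈ C.I j}.Finite) : IsMatched δ B C := by
  obtain ⟨φ, hφ, hR⟩ := h.exists_injective hC
  obtain ⟨ψ, hψ, hR'⟩ := h'.exists_injective hB
  obtain ⟨σ, h1, h2, h3⟩ := exists_pequiv_of_injective (Near δ B C) φ hφ hR ψ hψ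
    fun j => (hR' j).symm
  exact ⟨σ, h1, fun i hi => not_lt.1 (h2 i hi), fun j hj => not_lt.1 (h3 j hj)⟩

end Hall

/-! ### The matrix of a morphism -/

section Matrix

variable {K : Type u} [Field K] {B C : Barcode} {δ : ℝ≥0}

open Classical in
/-- The map `f_t`, extended by zero to the spaces spanned by all intervals. -/
noncomputable def extend (f : B.module K ⟶ shift δ ⋙ C.module K) (t : ℝ) :
    (B.ι →₀ K) →ₗ[K] (C.ι →₀ K) :=
  (Finsupp.supported K K {j | t + δ ∈ C.I j}).subtype ∘ₗ (f.app t).hom ∘ₗ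
    Finsupp.restrictDom K K {i | t ∈ B.I i}

variable (f : B.module K ⟶ shift δ ⋙ C.module K)

lemma mem_of_extend_single_ne_zero {t : ℝ} {i : B.ι} {j : C.ι}
    (h : extend f t (Finsupp.single i 1) j ≠ 0) : t ∈ B.I i ∧ t + δ ∈ C.I j := by
  classical
  constructor
  · by_contra hi
    refine h ?_
    have : Finsupp.restrictDom K K {i | t ∈ B.I i} (Finsupp.single i 1) = 0 :=
      Subtype.ext (Finsupp.filter_single_of_neg (fun i => t ∈ B.I i) hi)
    exact (congrArg (fun y => ((f.app t).hom y).1 j) this).trans <|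
      congrArg (fun y => y.1 j) (map_zero (f.app t).hom)
  · by_contra hj
    exact h ((Finsupp.mem_supported' _ _).1 ((f.app t).hom _).2 j hj)

open Classical in
lemma extend_filter {s t : ℝ} (hst : s ≤ t) {x : B.ι →₀ K} (hx : ∀ i, s ∉ B.I i → x i = 0) :
    extend f t x = (extend f s x).filter fun j => t + δ ∈ C.I j := by
  have hx' : x ∈ Finsupp.supported K K {i | s ∈ B.I i} := (Finsupp.mem_supported' _ _).2 hx
  have hr : Finsupp.restrictDom K K {i | s ∈ B.I i} x = ⟨x, hx'⟩ := by
    refine Subtype.ext ?_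
    rw [Finsupp.restrictDom_apply, Finsupp.filter_eq_self_iff]
    intro i hi
    by_contra hs
    exact hi (hx i hs)
  have := LinearMap.congr_fun (congrArg ModuleCat.Hom.hom (f.naturality (homOfLE hst))) ⟨x, hx'⟩
  have h2 := congrArg Subtype.val this
  refine h2.trans ?_
  rw [← hr]
  rfl

/-- This is naturality. Only `i` at the earlier time and `j` at the later one are assumed alive: if
`i` has died by `t`, or `j` is not yet born at `s + δ`, both sides vanish. This asymmetry is what
yields `Precedes` for nonzero entries. -/
lemma extend_single_eq {s t : ℝ} (hst : s ≤ t) {i : B.ι} {j : C.ι} (hs : s ∈ B.I i)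
    (ht : t + δ ∈ C.I j) :
    extend f t (Finsupp.single i 1) j = extend f s (Finsupp.single i 1) j := by
  classical
  rw [extend_filter f hst (fun k hk => Finsupp.single_eq_of_ne (fun e => hk (e ▸ hs))),
    Finsupp.filter_apply_pos (fun j => t + δ ∈ C.I j) _ ht]

open Classical in
/-- The matrix of a morphism `f` of direct sums of interval modules. -/
noncomputable def coeff (i : B.ι) (j : C.ι) : K :=
  if h : ∃ t, extend f t (Finsupp.single i 1) j ≠ 0 then
    extend f h.choose (Finsupp.single i 1) j else 0

lemma extend_single_eq_coeff {t : ℝ} {i : B.ι} {j : C.ι} (hi : t ∈ B.I i) (hj : t + δ ∈ C.I j) :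
    extend f t (Finsupp.single i 1) j = coeff f i j := by
  rw [coeff]
  split_ifs with h
  · obtain ⟨hi', hj'⟩ := mem_of_extend_single_ne_zero f h.choose_spec
    rcases le_total t h.choose with hle | hle
    · exact (extend_single_eq f hle hi hj').symm
    · exact extend_single_eq f hle hi' hj
  · by_contra h0
    exact h ⟨t, h0⟩

lemma precedes_of_coeff_ne_zero {i : B.ι} {j : C.ι} (h : coeff f i j ≠ 0) :
    Precedes δ B C i j := by
  rw [coeff] at h
  split_ifs at h with ht
  · set t := ht.choose
    obtain ⟨hi, hj⟩ := mem_of_extend_single_ne_zero f h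
    refine ⟨t, hi, hj, fun s hs hsi => ?_, fun s hs hsj => ?_⟩
    · refine (mem_of_extend_single_ne_zero f (t := s) (i := i) (j := j) ?_).2
      rwa [← extend_single_eq f hs hsi hj]
    · refine (mem_of_extend_single_ne_zero f (t := s) (i := i) (j := j) ?_).1
      rwa [extend_single_eq f hs hi hsj]
  · exact absurd rfl h

open Classical in
lemma extend_extend {f : B.module K ⟶ shift δ ⋙ C.module K}
    {g : C.module K ⟶ shift δ ⋙ B.module K} {t : ℝ} (i : t ⟶ t + δ + δ)
    (h : f.app t ≫ g.app (t + δ) = (B.module K).map i) {x : B.ι →₀ K}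
    (hx : ∀ i, t ∉ B.I i → x i = 0) :
    extend g (t + δ) (extend f t x) = x.filter fun k => t + δ + δ ∈ B.I k := by
  have hx' : x ∈ Finsupp.supported K K {i | t ∈ B.I i} := (Finsupp.mem_supported' _ _).2 hx
  have hr : ∀ (S : Set B.ι) (y : Finsupp.supported K K S), Finsupp.restrictDom K K S y.1 = y :=
    fun S y => LinearMap.congr_fun (Finsupp.restrictDom_comp_subtype S) y
  have hr' : ∀ (S : Set C.ι) (y : Finsupp.supported K K S), Finsupp.restrictDom K K S y.1 = y :=
    fun S y => LinearMap.congr_fun (Finsupp.restrictDom_comp_subtype S) y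
  have h2 := congrArg Subtype.val
    (LinearMap.congr_fun (congrArg ModuleCat.Hom.hom h) ⟨x, hx'⟩)
  refine Eq.trans ?_ h2
  change ((g.app (t + δ)).hom (Finsupp.restrictDom K K {j | t + δ ∈ C.I j}
    ((f.app t).hom (Finsupp.restrictDom K K {i | t ∈ B.I i} x)).1)).1 = _
  erw [hr' {j | t + δ ∈ C.I j}, hr {i | t ∈ B.I i} ⟨x, hx'⟩]
  rfl

/-- The composite at `t` is evaluated on the basis vector `i` and read at `k`, where the transition
map has the entry of the identity. -/
lemma isSection_coeff {f : B.module K ⟶ shift δ ⋙ C.module K}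
    {g : C.module K ⟶ shift δ ⋙ B.module K}
    (h : ∀ (t : ℝ) (i : t ⟶ t + δ + δ), f.app t ≫ g.app (t + δ) = (B.module K).map i) :
    IsSection δ (coeff f) (coeff g) where
  precedes_left i j := precedes_of_coeff_ne_zero f
  precedes_right j k := precedes_of_coeff_ne_zero g
  sum_eq i k t hi hk N hN := by
    classical
    have ht : t ≤ t + δ + δ := by have := δ.2; linarith
    have e := DFunLike.congr_fun (extend_extend (homOfLE ht) (h t (homOfLE ht))
      (x := Finsupp.single i 1) fun k hk => Finsupp.single_eq_of_ne (fun e => hk (e ▸ hi))) k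
    rw [Finsupp.filter_apply_pos (fun k => t + δ + δ ∈ B.I k) _ hk] at e
    rw [← e]
    set y := extend f t (Finsupp.single i 1) with hy
    -- If `j` is not alive at `t + δ`, the left side is zero, and so is the right side by
    -- `Precedes.mem`.
    have hterm : ∀ j, y j * extend g (t + δ) (Finsupp.single j 1) k = coeff f i j * coeff g j k := by
      intro j
      by_cases hj : t + δ ∈ C.I j
      · rw [hy, extend_single_eq_coeff f hi hj, extend_single_eq_coeff g hj hk]
      · have h1 : y j = 0 := by
          by_contra h0
          exact hj (mem_of_extend_single_ne_zero f h0).2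
        rw [h1, zero_mul]
        by_contra h0
        exact hj ((precedes_of_coeff_ne_zero f (left_ne_zero_of_mul (Ne.symm h0))).mem
          (precedes_of_coeff_ne_zero g (right_ne_zero_of_mul (Ne.symm h0))) hi hk)
    have hsum : extend g (t + δ) y k = ∑ j ∈ y.support, coeff f i j * coeff g j k := by
      conv_lhs => rw [← Finsupp.sum_single y, Finsupp.sum, map_sum, Finsupp.finsetSum_apply]
      refine Finset.sum_congr rfl fun j _ => ?_
      rw [← hterm j, ← Finsupp.smul_single_one, map_smul]
      rfl
    -- Both `N` and the support of `y` contain every index with a nonzero product, so both sums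
    -- agree with the sum over the union.
    rw [hsum, Finset.sum_subset (Finset.subset_union_left (s₁ := N) (s₂ := y.support))
      fun j _ hj => hN j hj]
    refine (Finset.sum_subset Finset.subset_union_right fun j _ hj => ?_).symm
    rw [← hterm, Finsupp.notMem_support_iff.1 hj, zero_mul]

/-! ### Algebraic stability for pointwise finite-dimensional modules -/

lemma finite_setOf_mem (B : Barcode) (t : ℝ) (h : Module.Finite K ((B.module K).obj t)) :
    {i | t ∈ B.I i}.Finite := by
  have h' : Module.Finite K (Finsupp.supported K K {i | t ∈ B.I i}) := h
  have := Module.Finite.equiv (Finsupp.supportedEquivFinsupp (M := K) (R := K) {i | t ∈ B.I i})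
  have := Module.Finite.finite_basis (Finsupp.basisSingleOne (R := K) (ι := {i | t ∈ B.I i}))
  exact Set.toFinite _

/-- This transports an interleaving relation along the isomorphisms to the sums of interval modules.
-/
lemma conj_comp_conj {V : Type*} [Category V] {M₀ M₂ N₁ B₀ B₂ C₁ : V} {a : B₀ ⟶ M₀} {f : M₀ ⟶ N₁}
    {b : N₁ ⟶ C₁} {b' : C₁ ⟶ N₁} {g : N₁ ⟶ M₂} {a' : M₂ ⟶ B₂} {m : M₀ ⟶ M₂} {m' : B₀ ⟶ B₂}
    (hb : b ≫ b' = 𝟙 N₁) (hm : f ≫ g = m) (hm' : a ≫ m ≫ a' = m') :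
    (a ≫ f ≫ b) ≫ b' ≫ g ≫ a' = m' := by
  subst hm hm'
  simp [reassoc_of% hb]

/-- The algebraic stability theorem: pointwise finite-dimensional persistence modules that are
`δ`-interleaved have `δ`-matched persistence diagrams. -/
theorem isMatched_of_isInterleaved {M N : ℝ ⥤ ModuleCat.{u} K}
    (hM : ∀ t, Module.Finite K (M.obj t)) (hN : ∀ t, Module.Finite K (N.obj t))
    (hB : B.IsDiagram M) (hC : C.IsDiagram N) (h : IsInterleaved δ M N) : IsMatched δ B C := by
  obtain ⟨a⟩ := hB
  obtain ⟨b⟩ := hC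
  obtain ⟨f, g, hf, hg⟩ := h
  have hfB : ∀ t, {i | t ∈ B.I i}.Finite := fun t => finite_setOf_mem B t
    (have := hM t; Module.Finite.equiv (a.app t).toLinearEquiv)
  have hfC : ∀ t, {j | t ∈ C.I j}.Finite := fun t => finite_setOf_mem C t
    (have := hN t; Module.Finite.equiv (b.app t).toLinearEquiv)
  refine isMatched_of_isSection (c := coeff (a.inv ≫ f ≫ Functor.whiskerLeft (shift δ) b.hom))
    (d := coeff (b.inv ≫ g ≫ Functor.whiskerLeft (shift δ) a.hom))
    (isSection_coeff fun t i => ?_) (isSection_coeff fun t i => ?_) hfB hfC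
  · refine conj_comp_conj (b.hom_inv_id_app _) (hf t) ?_
    exact (congrArg (a.inv.app t ≫ ·) (a.hom.naturality i)).trans (a.inv_hom_id_app_assoc t _)
  · refine conj_comp_conj (a.hom_inv_id_app _) (hg t) ?_
    exact (congrArg (b.inv.app t ≫ ·) (b.hom.naturality i)).trans (b.inv_hom_id_app_assoc t _)

end Matrix

end Barcode

end SampledMap

/-! ### Stability of the persistence module of a map -/

theorem corollary5p2 {K : Type*} [Field K] (H : TopCat.{0} ⥤ ModuleCat K)
    (hH : (∃ k : ℕ, H = SampledMap.homology K k) ∨ H = SampledMap.totalHomology K) (n : ℕ) :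
    (∀ (U U' : Set (EuclideanSpace ℝ (Fin n)))
      (h : U → EuclideanSpace ℝ (Fin n)) (h' : U' → EuclideanSpace ℝ (Fin n))
      (D : SampledMap.MapDecomposition H h) (D' : SampledMap.MapDecomposition H h'),
      SampledMap.interleavingDist (SampledMap.mapModule D) (SampledMap.mapModule D') ≤
        Metric.hausdorffEDist (SampledMap.graph h) (SampledMap.graph h')) ∧
    (∀ (X S : Set (EuclideanSpace ℝ (Fin n))) (hS : S ⊆ X) (f : X → EuclideanSpace ℝ (Fin n))
      (D : SampledMap.MapDecomposition H f)
      (D' : SampledMap.MapDecomposition H (f ∘ Set.inclusion hS))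
      (B B' : SampledMap.Barcode),
      B.IsDiagram (SampledMap.mapModule D) → B'.IsDiagram (SampledMap.mapModule D') →
      SampledMap.Barcode.bottleneckDist B' B ≤
        Metric.hausdorffEDist (SampledMap.graph f)
          (SampledMap.graph (f ∘ Set.inclusion hS))) := by
  refine ⟨fun U U' h h' D D' => SampledMap.iInf_coe_le_of_forall fun δ hδ =>
    SampledMap.isInterleaved_mapModule D D' hδ, fun X S hS f D D' B B' hB hB' => ?_⟩
  -- The bottleneck distance is taken from `B'` to `B`, so the interleaving is used from the
  -- restricted map to `f`.
  rw [Metric.hausdorffEDist_comm]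
  exact SampledMap.iInf_coe_le_of_forall fun δ hδ =>
    SampledMap.Barcode.isMatched_of_isInterleaved (SampledMap.finite_mapModule D')
      (SampledMap.finite_mapModule D) hB' hB (SampledMap.isInterleaved_mapModule D' D hδ)
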